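/- Let $E$ be a finite set, $e_0\in E$ a fixed point, $P=(p_{ij})_{i,j\in E}$ a stochastic matrix, $L$ the set of all maps $\beta:E\to E$, and $G=E\times L$. Let $q=(q_\beta)_{\beta\in L}$ be a probability on $L$ with $P=\sum_{\beta}q_\beta D_\beta$, where $(D_\beta)_{ij}=\delta_{\beta(i),j}$, and let $\varphi:E\times G\to E\times G$ be a bijection with $\varphi(i,(e_0,\beta))=(\beta(i),(i,\beta))$ for all $i\in E$, $\beta\in L$. On $E\times G^{\mathbb Z}$ let $\alpha=\vartheta\circ\varphi_1$, where $\varphi_1$ applies $\varphi$ to the $E$-component and to the component $g_1$ of $(g_n)_{n\in\mathbb Z}\in G^{\mathbb Z}$, and $\vartheta$ is the shift $(g_n)_n\mapsto(g_{n+1})_n$. Let $\widetilde q=\delta_{e_0}\otimes q$ on $G$, $Q_P=\bigotimes_{\mathbb Z}\widetilde q$, and $\mathbb P_{k,P}=\delta_k\otimes Q_P$ for $k\in E$. Put $\mathcal H=\mathbb C^{|E|}$ and $\mathfrak Z=\mathbb C^{|G|}$ with their canonical bases, $V=\sum_{i\in E,\,g\in G}|\varphi(i,g)\rangle\langle i,g|$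 on $\mathcal H\otimes\mathfrak Z$, and $\phi=\sum_{\beta}\sqrt{q_\beta}\,|e_0,\beta\rangle\in\mathfrak Z$. Let $\mathcal K=\bigotimes_{n\in\mathbb Z}\mathfrak Z_n$, with copies $\mathfrak Z_n$ of $\mathfrak Z$, be the Hilbert space tensor product with respect to the constant stabilizing sequence $\phi$, let $\Psi=\bigotimes_{\mathbb Z}\phi\in\mathcal K$, and let $U=\Theta V_1$ on $\mathcal H\otimes\mathcal K$, where $V_1$ is $V$ acting on $\mathcal H\otimes\mathfrak Z_1$ and $\Theta$ is the shift $h\otimes\bigotimes_n z_n\mapsto h\otimes\bigotimes_n z_{n+1}$. For a trace class operator $\sigma$ on $\mathcal K$ let $\mathbb E_\sigma[A]$ denote the operator on $\mathcal H$ with $\operatorname{tr}[\mathbb E_\sigma[A]\rho]=\operatorname{tr}[A\,(\rho\otimes\sigma)]$ for all states (density operators) $\rho$ on $\mathcal H$, and similarly for $\mathfrak Z$ in place of $\mathcal K$. Let $\sigma_\phi=|\phi\rangle\langle\phi|$ and $\sigma_\Psi=|\Psi\rangle\langle\Psi|$. Then there are a completely positive, identity preserving linear map $T$ on $\mathcal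 B(\mathcal H)$, an injective unital $*$-homomorphism $f\mapsto m_f$ from the functions $f:E\to\mathbb C$ to $\mathcal B(\mathcal H)$, states $\rho_k$ ($k\in E$) on $\mathcal H$, and an injective unital $*$-homomorphism $F\mapsto m_F$ from the continuous functions $C(E\times G^{\mathbb Z})$ to $\mathcal B(\mathcal H\otimes\mathcal K)$, with $m_{F}=m_f\otimes 1$ whenever $F(i,\gamma)=f(i)$, such that: 1. $(\mathfrak Z,V,\phi)$ is a dilation of $T$: $T[a]=\mathbb E_{\sigma_\phi}[V^*(a\otimes 1)V]$ for all $a\in\mathcal B(\mathcal H)$; 2. $(T^t)_{t\ge0}$ extends $(P^t)_{t\ge0}$: $T[m_f]=m_{Pf}$ and $(P^tf)(k)=\operatorname{tr}\big[T^t[m_f]\,\rho_k\big]$ for all $f$, $k\in E$, $t\ge0$; 3. $(\mathcal K,U,\Psi)$ is a dilation of $(T^t)_{t\ge0}$: $T^t[a]=\mathbb E_{\sigma_\Psi}[U^{*t}(a\otimes1)U^t]$ for all $a\in\mathcal B(\mathcal H)$, $t\ge0$; 4. this dilation extends the classical dilation $(G^{\mathbb Z},\alpha,Q_P)$: $U^{*t}\,m_F\,U^t=m_{F\circ\alpha^t}$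 for all $F\in C(E\times G^{\mathbb Z})$, $t\in\mathbb Z$, and $$\mathbb E_{k,P}\big[\eta(F_1,\dots,F_n)\big]=\operatorname{tr}\big[\eta(m_{F_1},\dots,m_{F_n})\,(\rho_k\otimes|\Psi\rangle\langle\Psi|)\big]$$ for all $k\in E$, $n\ge0$, $F_1,\dots,F_n\in C(E\times G^{\mathbb Z})$ and all bounded continuous $\eta:\mathbb C^n\to\mathbb R$, where $\eta(m_{F_1},\dots,m_{F_n})$ is the joint continuous functional calculus of commuting normal operators. -/

import Mathlib

open scoped TensorProduct CStarAlgebra InnerProductSpace BoundedContinuousFunction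

noncomputable section

namespace MarkovDilation

/-! ## Hilbert space tensor products -/

section HilbertTensor

variable {H H' K K' : Type*}
  [NormedAddCommGroup H] [InnerProductSpace ℂ H] [NormedAddCommGroup H'] [InnerProductSpace ℂ H']
  [NormedAddCommGroup K] [InnerProductSpace ℂ K] [NormedAddCommGroup K'] [InnerProductSpace ℂ K']

/-- The Hilbert space tensor product: the completion of the algebraic tensor product for the inner
product `⟪h ⊗ k, h' ⊗ k'⟫ = ⟪h, h'⟫ ⟪k, k'⟫`. -/
abbrev HilbertTensor (H K : Type*) [NormedAddCommGroup H] [InnerProductSpace ℂ H]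
    [NormedAddCommGroup K] [InnerProductSpace ℂ K] : Type _ :=
  UniformSpace.Completion (H ⊗[ℂ] K)

/-- The product vector `h ⊗ k`. -/
def vecTensor (h : H) (k : K) : HilbertTensor H K :=
  ((h ⊗ₜ[ℂ] k : H ⊗[ℂ] K) : UniformSpace.Completion (H ⊗[ℂ] K))

/-- The bounded operator `a ⊗ b`. -/
def opTensor (a : H →L[ℂ] H') (b : K →L[ℂ] K') : HilbertTensor H K →L[ℂ] HilbertTensor H' K' :=
  (TensorProduct.mapL a b).completion

end HilbertTensor

/-- The extension of a linear isometric equivalence to the completions. -/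
def completionEquiv {X Y : Type*} [NormedAddCommGroup X] [InnerProductSpace ℂ X]
    [NormedAddCommGroup Y] [InnerProductSpace ℂ Y] (e : X ≃ₗᵢ[ℂ] Y) :
    UniformSpace.Completion X ≃ₗᵢ[ℂ] UniformSpace.Completion Y :=
  have h1 : ∀ x, (e.symm : Y →L[ℂ] X).completion ((e : X →L[ℂ] Y).completion x) = x := by
    intro x
    induction x using UniformSpace.Completion.induction_on with
    | hp => exact isClosed_eq (by fun_prop) (by fun_prop)
    | ih x => simp
  have h2 : ∀ y, (e : X →L[ℂ] Y).completion ((e.symm : Y →L[ℂ] X).completion y) = y := by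
    intro x
    induction x using UniformSpace.Completion.induction_on with
    | hp => exact isClosed_eq (by fun_prop) (by fun_prop)
    | ih x => simp
  have h3 : ∀ x, ‖(e : X →L[ℂ] Y).completion x‖ = ‖x‖ := by
    intro x
    induction x using UniformSpace.Completion.induction_on with
    | hp => exact isClosed_eq (by fun_prop) (by fun_prop)
    | ih x => simp
  { toFun := (e : X →L[ℂ] Y).completion
    map_add' := fun x y => map_add _ x y
    map_smul' := fun c x => map_smul _ c x
    invFun := (e.symm : Y →L[ℂ] X).completion
    left_inv := h1
    right_inv := h2
    norm_map' := h3 }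

/-! ## Infinite tensor products along a stabilizing sequence -/

section InfiniteTensor

variable {ι Z : Type*} [NormedAddCommGroup Z] [InnerProductSpace ℂ Z]

/-- Families of vectors which agree with the stabilizing family `ψ` at all but finitely many
indices. -/
structure StabFamily (ψ : ι → Metric.sphere (0 : Z) 1) where
  /-- the vectors of the family -/
  vec : ι → Z
  /-- agreement with `ψ` at all but finitely many indices -/
  finite_ne : {n | vec n ≠ (ψ n : Z)}.Finite

variable (ψ : ι → Metric.sphere (0 : Z) 1)

/-- The scalar kernel `∏ₙ ⟪uₙ, vₙ⟫`; all but finitely many factors are `1`. -/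
def stabKernel (u v : StabFamily ψ) : ℂ := ∏ᶠ n, ⟪u.vec n, v.vec n⟫_ℂ

lemma hasFiniteMulSupport_inner (u v : StabFamily ψ) :
    (Function.mulSupport fun n => ⟪u.vec n, v.vec n⟫_ℂ).Finite := by
  refine (u.finite_ne.union v.finite_ne).subset fun n hn => ?_
  by_contra h
  simp only [Set.mem_union, Set.mem_ofPred_eq, not_or, not_not] at h
  apply hn
  simp [h.1, h.2, inner_self_eq_norm_sq_to_K]

open ComplexOrder in
lemma posSemidef_prod_inner {J : Type*} [Finite J] (w : J → ι → Z) (s : Finset ι) :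
    (Matrix.of fun i j => ∏ n ∈ s, ⟪w i n, w j n⟫_ℂ).PosSemidef := by
  classical
  induction s using Finset.induction_on with
  | empty =>
    convert! Matrix.posSemidef_gram ℂ (fun _ : J => (1 : ℂ)) using 1
    ext i j
    simp [Matrix.gram]
  | insert a s ha ih =>
    convert! (Matrix.posSemidef_gram ℂ (fun i => w i a)).hadamard ih using 1
    ext i j
    simp [Matrix.gram, Matrix.hadamard, Finset.prod_insert ha]

lemma exists_stabKernel_eq_prod (T : Finset (StabFamily ψ)) :
    ∃ s : Finset ι, ∀ u ∈ T, ∀ v ∈ T, stabKernel ψ u v = ∏ n ∈ s, ⟪u.vec n, v.vec n⟫_ℂ := by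
  classical
  refine ⟨T.biUnion fun u => u.finite_ne.toFinset, fun u hu v hv => ?_⟩
  refine finprod_eq_prod_of_mulSupport_subset _ fun n hn => ?_
  simp only [Finset.coe_biUnion, Set.mem_iUnion, Set.Finite.coe_toFinset]
  by_contra h
  have h1 : u.vec n = ψ n := by
    by_contra h'
    exact h ⟨u, hu, h'⟩
  have h2 : v.vec n = ψ n := by
    by_contra h'
    exact h ⟨v, hv, h'⟩
  apply hn
  simp [h1, h2, inner_self_eq_norm_sq_to_K]

lemma stabKernel_conj (u v : StabFamily ψ) :
    (starRingEnd ℂ) (stabKernel ψ u v) = stabKernel ψ v u := by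
  classical
  obtain ⟨s, hs⟩ := exists_stabKernel_eq_prod ψ {u, v}
  rw [hs u (by simp) v (by simp), hs v (by simp) u (by simp), map_prod]
  simp

/-- The kernel, with values in the bounded operators on `ℂ`. -/
def stabMatrix : Matrix (StabFamily ψ) (StabFamily ψ) (ℂ →L[ℂ] ℂ) :=
  Matrix.of fun u v => stabKernel ψ u v • ContinuousLinearMap.id ℂ ℂ

open ComplexOrder in
instance posSemidef_stabMatrix : Fact (stabMatrix ψ).PosSemidef := by
  classical
  have key := ((RKHS.posSemidef_tfae (K := stabMatrix ψ)).out 0 2).mpr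
  refine ⟨key ⟨?_, fun x => ?_⟩⟩
  · ext u v
    have h : star (ContinuousLinearMap.id ℂ ℂ) = ContinuousLinearMap.id ℂ ℂ := star_one _
    simp [stabMatrix, Matrix.conjTranspose_apply, stabKernel_conj, h]
  · obtain ⟨s, hs⟩ := exists_stabKernel_eq_prod ψ x.support
    have h := (posSemidef_prod_inner (fun u : x.support => u.1.vec) s).dotProduct_mulVec_nonneg
      (fun u => x u.1)
    refine (Complex.le_def.mp h).1.trans_eq (congrArg Complex.re ?_)
    rw [Finsupp.sum, ← Finset.sum_attach]
    simp only [dotProduct, Matrix.mulVec, Finset.mul_sum]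
    rw [Finset.univ_eq_attach]
    refine Finset.sum_congr rfl fun u _ => ?_
    rw [Finsupp.sum, ← Finset.sum_attach x.support]
    refine Finset.sum_congr rfl fun v _ => ?_
    simp only [stabMatrix, Matrix.of_apply, smul_apply,
      ContinuousLinearMap.id_apply, RCLike.inner_apply, smul_eq_mul, map_mul, stabKernel_conj,
      hs u.1 u.2 v.1 v.2, Pi.star_apply, RCLike.star_def]
    ring

/-- The infinite tensor product `⨂ₙ Zₙ` of copies `Zₙ` of `Z` with respect to the stabilizing
family `ψ` of unit vectors: the Hilbert space generated by product vectors `⨂ₙ uₙ`, with `u`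
agreeing with `ψ` at all but finitely many indices, and the inner product
`⟪⨂ₙ uₙ, ⨂ₙ vₙ⟫ = ∏ₙ ⟪uₙ, vₙ⟫`. -/
abbrev InfTensor : Type _ := RKHS.OfKernel (stabMatrix ψ)

/-- The product vector `⨂ₙ uₙ`. -/
def tprod (u : StabFamily ψ) : InfTensor ψ := RKHS.kerFun (InfTensor ψ) u (1 : ℂ)

lemma inner_tprod (u v : StabFamily ψ) :
    ⟪tprod ψ u, tprod ψ v⟫_ℂ = ∏ᶠ n, ⟪u.vec n, v.vec n⟫_ℂ := by
  rw [tprod, tprod, ← RKHS.kernel_inner, RKHS.OfKernel.kernel_ofKernel]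
  simp [stabMatrix, stabKernel_conj]
  rfl

variable {ψ} in
/-- Replacing the `n`-th vector of a family by `w`. -/
def StabFamily.update (u : StabFamily ψ) (n : ι) (w : Z) : StabFamily ψ := by
  classical
  exact ⟨Function.update u.vec n w, (u.finite_ne.insert n).subset fun m hm => by
    by_cases h : m = n
    · exact Or.inl h
    · exact Or.inr (by simpa [h] using hm)⟩

lemma tprod_apply (u v : StabFamily ψ) : tprod ψ v u = stabKernel ψ u v := by
  rw [tprod, RKHS.kerFun_apply, RKHS.OfKernel.kernel_ofKernel]
  simp [stabMatrix]

lemma stabKernel_update_right (v u : StabFamily ψ) (n : ι) (w : Z) :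
    stabKernel ψ v (u.update n w) =
      ⟪v.vec n, w⟫_ℂ * ∏ᶠ (m : ι) (_ : m ≠ n), ⟪v.vec m, u.vec m⟫_ℂ := by
  rw [stabKernel, ← mul_finprod_cond_ne n (hasFiniteMulSupport_inner ψ v (u.update n w))]
  congr 1
  · simp [StabFamily.update]
  · refine finprod_congr fun m => finprod_congr fun hm => ?_
    simp [StabFamily.update, hm]

/-- The bounded operator `Z → ⨂ₙ Zₙ` which puts its argument at the `n`-th place of the product
vector `⨂ₙ uₙ`. -/
def siteMap (u : StabFamily ψ) (n : ι) : Z →L[ℂ] InfTensor ψ :=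
  LinearMap.mkContinuous
    { toFun := fun w => tprod ψ (u.update n w)
      map_add' := fun w w' => by
        refine RKHS.ext fun v => ?_
        rw [RKHS.coe_add, Pi.add_apply]
        simp only [tprod_apply, stabKernel_update_right, inner_add_right, add_mul]
      map_smul' := fun c w => by
        refine RKHS.ext fun v => ?_
        rw [RKHS.coe_smul, Pi.smul_apply]
        simp only [tprod_apply, stabKernel_update_right, inner_smul_right, RingHom.id_apply,
          smul_eq_mul, mul_assoc] }
    (Real.sqrt ‖∏ᶠ (m : ι) (_ : m ≠ n), ⟪u.vec m, u.vec m⟫_ℂ‖) fun w => by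
      have h : ‖tprod ψ (u.update n w)‖ ^ 2 =
          ‖∏ᶠ (m : ι) (_ : m ≠ n), ⟪u.vec m, u.vec m⟫_ℂ‖ * ‖w‖ ^ 2 := by
        have h1 : ((‖tprod ψ (u.update n w)‖ ^ 2 : ℝ) : ℂ) =
            ((‖w‖ ^ 2 : ℝ) : ℂ) * ∏ᶠ (m : ι) (_ : m ≠ n), ⟪u.vec m, u.vec m⟫_ℂ := by
          push_cast
          refine (inner_self_eq_norm_sq_to_K (𝕜 := ℂ) (tprod ψ (u.update n w))).symm.trans ?_
          rw [inner_tprod,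
            ← mul_finprod_cond_ne n (hasFiniteMulSupport_inner ψ (u.update n w) (u.update n w))]
          congr 1
          · simp [StabFamily.update, inner_self_eq_norm_sq_to_K]
          · refine finprod_congr fun m => finprod_congr fun hm => ?_
            simp [StabFamily.update, hm]
        have h2 := congrArg norm h1
        rw [norm_mul, Complex.norm_real, Complex.norm_real, Real.norm_of_nonneg (by positivity),
          Real.norm_of_nonneg (by positivity)] at h2
        rw [h2, mul_comm]
      refine le_of_eq ?_
      change ‖tprod ψ (u.update n w)‖ = _
      rw [← Real.sqrt_sq (norm_nonneg (tprod ψ (u.update n w))), h,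
        Real.sqrt_mul (norm_nonneg _), Real.sqrt_sq (norm_nonneg _)]

end InfiniteTensor

/-! ## Traces, states, conditional expectations, functional calculus -/

section Quantum

/-- The bounded operators on `X`. -/
abbrev Op (X : Type*) [NormedAddCommGroup X] [InnerProductSpace ℂ X] : Type _ := X →L[ℂ] X

variable {H K Z : Type*}
  [NormedAddCommGroup H] [InnerProductSpace ℂ H] [CompleteSpace H]
  [NormedAddCommGroup K] [InnerProductSpace ℂ K] [CompleteSpace K]
  [NormedAddCommGroup Z] [InnerProductSpace ℂ Z] [CompleteSpace Z]

/-- `A` is trace class with trace `c`: the series `∑ ⟪e, A e⟫` converges (unconditionally) to `c`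
along every orthonormal basis. -/
def HasTrace (A : Op H) (c : ℂ) : Prop :=
  ∀ (S : Set H) (b : HilbertBasis S ℂ H), HasSum (fun s => ⟪b s, A (b s)⟫_ℂ) c

/-- The states (density operators) of `H`. -/
def IsState (ρ : Op H) : Prop := 0 ≤ ρ ∧ HasTrace ρ 1

/-- The operator `|h⟩⟨h|`. -/
def pureState (h : H) : Op H := InnerProductSpace.rankOne ℂ h h

/-- `B` is the conditional expectation `𝔼_σ[A]`: `tr[B ρ] = tr[A (ρ ⊗ σ)]` for all states `ρ`. -/
def IsCondExp (σ : Op K) (A : Op (HilbertTensor H K)) (B : Op H) : Prop :=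
  ∀ ρ : Op H, IsState ρ → ∃ c : ℂ, HasTrace (B * ρ) c ∧ HasTrace (A * opTensor ρ σ) c

/-- A stochastic map on `𝓑(H)`: completely positive, linear and identity preserving. -/
def IsStochasticMap (T : Op H →ₗ[ℂ] Op H) : Prop :=
  (∃ S : Op H →CP Op H, S.toLinearMap = T) ∧ T 1 = 1

/-- The automorphism `A ↦ U* A U`. -/
def conjBy {A : Type*} [Monoid A] [StarMul A] (U : unitary A) (a : A) : A :=
  star (U : A) * a * (U : A)

/-- `(Z, V, σ)` is a dilation of the stochastic map `T`: `T[a] = 𝔼_σ[V* (a ⊗ 1) V]`. -/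
def IsDilation (T : Op H →ₗ[ℂ] Op H)
    (V : unitary (Op (HilbertTensor H Z))) (σ : Op Z) : Prop :=
  IsState σ ∧ ∀ a : Op H,
    IsCondExp σ (conjBy V (opTensor a 1)) (T a)

/-- `(K, U, σ)` is a dilation of the quantum dynamical semigroup `(T ^ t)` by the group of
`*`-automorphisms `A ↦ U*ᵗ A Uᵗ`: `Tᵗ[a] = 𝔼_σ[U*ᵗ (a ⊗ 1) Uᵗ]`. -/
def IsSemigroupDilation (T : Op H →ₗ[ℂ] Op H)
    (U : unitary (Op (HilbertTensor H K))) (σ : Op K) : Prop :=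
  ∀ t : ℕ, IsDilation (T ^ t) (U ^ t) σ

/-- `B = η(a₁, …, aₙ)` in the joint continuous functional calculus of the commuting normal
elements `a₁, …, aₙ`: for a compact set `S` there is a unital `*`-homomorphism on `C(S)` which
sends the coordinate functions to the `aᵢ` and the restriction of `η` to `B`. By the
Stone-Weierstrass theorem there is at most one such `B`. -/
def IsJointCFC {A : Type*} [CStarAlgebra A] {n : ℕ} (a : Fin n → A) (η : C(Fin n → ℂ, ℂ))
    (B : A) : Prop :=
  ∃ S : Set (Fin n → ℂ), IsCompact S ∧ ∃ Φ : C(S, ℂ) →⋆ₐ[ℂ] A,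
    (∀ i, Φ ⟨fun z => z.1 i, (continuous_apply i).comp continuous_subtype_val⟩ = a i) ∧
      Φ (η.restrict S) = B

/-! ## The dilation of `(T ^ t)` associated with a dilation of `T` -/

/-- `Vₙ` is the operator `V` on `H ⊗ Zₙ`, extended to `H ⊗ ⨂ₘ Zₘ` by the identity on the other
factors: it intertwines the embeddings of `H ⊗ Z` which complete `h ⊗ w` by fixed vectors at the
places other than `n`. This determines `Vₙ`. -/
def IsAmpliation {ι : Type*} (ψ : ι → Metric.sphere (0 : Z) 1) (n : ι)
    (V : Op (HilbertTensor H Z))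
    (Vn : Op (HilbertTensor H (InfTensor ψ))) : Prop :=
  ∀ u : StabFamily ψ,
    Vn ∘L opTensor (ContinuousLinearMap.id ℂ H) (siteMap ψ u n) =
      opTensor (ContinuousLinearMap.id ℂ H) (siteMap ψ u n) ∘L V

/-- The infinite tensor product `⨂_{n ∈ ℤ} Z` with respect to the constant sequence `φ`. -/
abbrev StabTensor (φ : Metric.sphere (0 : Z) 1) : Type _ := InfTensor fun _ : ℤ => φ

/-- The shift of a family indexed by `ℤ`: its `n`-th member is the `(n+1)`-st of the given one. -/
def StabFamily.shift {φ : Metric.sphere (0 : Z) 1} (u : StabFamily (fun _ : ℤ => φ)) :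
    StabFamily (fun _ : ℤ => φ) :=
  ⟨fun n => u.vec (n + 1), u.finite_ne.preimage (add_left_injective (1 : ℤ)).injOn⟩

/-- `Θ` is the shift `h ⊗ ⨂ₙ uₙ ↦ h ⊗ ⨂ₙ uₙ₊₁`. This determines `Θ`. -/
def IsShift (φ : Metric.sphere (0 : Z) 1)
    (Θ : Op (HilbertTensor H (StabTensor φ))) : Prop :=
  ∀ (h : H) (u : StabFamily fun _ : ℤ => φ),
    Θ (vecTensor h (tprod _ u)) = vecTensor h (tprod _ u.shift)

/-- `U = Θ V₁`, the one-step evolution on `H ⊗ ⨂_ℤ Z` associated with the unitary `V` on `H ⊗ Z`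
and the unit vector `φ` of `Z`. -/
def IsAssociatedEvolution (V : unitary (Op (HilbertTensor H Z)))
    (φ : Metric.sphere (0 : Z) 1)
    (U : unitary (Op (HilbertTensor H (StabTensor φ)))) : Prop :=
  ∃ Θ V₁ : unitary (Op (HilbertTensor H (StabTensor φ))),
    IsShift φ (Θ : Op (HilbertTensor H (StabTensor φ))) ∧
      IsAmpliation (fun _ : ℤ => φ) 1 (V : Op (HilbertTensor H Z)) V₁ ∧ U = Θ * V₁

/-- The vector `⨂_ℤ φ`. -/
def constVec (φ : Metric.sphere (0 : Z) 1) : StabTensor φ :=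
  tprod _ ⟨fun _ => φ, by simp⟩

end Quantum

/-! ## The classical dilation -/

section Classical

/-- The labels of the automaton: all maps `β : E → E`. The one-site environment is `G = E × L`. -/
abbrev Site (E : Type*) : Type _ := E × (E → E)

/-- `P = ∑_β q_β D_β`, where `D_β` is the deterministic matrix `(δ_{β(i), j})`. -/
def IsDeterministicMixture {E : Type*} [Fintype E] [DecidableEq E] (P : Matrix E E ℝ)
    (q : PMF (E → E)) : Prop :=
  P = ∑ β : E → E, (q β).toReal • Matrix.of fun i j => if β i = j then (1 : ℝ) else 0

/-- `φ` is an invertible coupling on `E × G` with `φ(i, (e₀, β)) = (β(i), (i, β))`. -/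
def IsCoupling {E : Type*} (e₀ : E) (φ : Equiv.Perm (E × Site E)) : Prop :=
  ∀ (i : E) (β : E → E), φ (i, (e₀, β)) = (β i, (i, β))

/-- The distribution `δ_{e₀} ⊗ q` on `G`. -/
def siteLaw {E : Type*} (e₀ : E) (q : PMF (E → E)) : PMF (Site E) := q.map fun β => (e₀, β)

variable {E G : Type*}

/-- The coupling `φ` acting on the system and the first component of the environment. -/
def couplingMap (φ : Equiv.Perm (E × G)) (x : E × (ℤ → G)) : E × (ℤ → G) :=
  ((φ (x.1, x.2 1)).1, Function.update x.2 1 (φ (x.1, x.2 1)).2)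

lemma couplingMap_symm (φ : Equiv.Perm (E × G)) (x : E × (ℤ → G)) :
    couplingMap φ.symm (couplingMap φ x) = x := by
  simp [couplingMap]

variable [TopologicalSpace E] [DiscreteTopology E] [TopologicalSpace G] [DiscreteTopology G]

lemma continuous_couplingMap (φ : Equiv.Perm (E × G)) : Continuous (couplingMap φ) := by
  have h : Continuous fun x : E × (ℤ → G) => φ (x.1, x.2 1) :=
    continuous_of_discreteTopology.comp (by fun_prop)
  exact h.fst.prodMk (continuous_snd.update 1 h.snd)

/-- The global one-step evolution `α = ϑ ∘ φ₁` on `E × G^ℤ`, where `ϑ` is the shift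
`(gₙ)ₙ ↦ (gₙ₊₁)ₙ`. -/
def globalMap (φ : Equiv.Perm (E × G)) : (E × (ℤ → G)) ≃ₜ (E × (ℤ → G)) :=
  Homeomorph.trans
    { toFun := couplingMap φ
      invFun := couplingMap φ.symm
      left_inv := couplingMap_symm φ
      right_inv := couplingMap_symm φ.symm
      continuous_toFun := continuous_couplingMap φ
      continuous_invFun := continuous_couplingMap φ.symm }
    { toFun := fun x => (x.1, fun n => x.2 (n + 1))
      invFun := fun x => (x.1, fun n => x.2 (n - 1))
      left_inv := fun x => by simp
      right_inv := fun x => by simp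
      continuous_toFun := by fun_prop
      continuous_invFun := by fun_prop }

end Classical

/-! ## Quantum extensions of classical evolutions -/

section Extension

variable {E G H K : Type*}
  [NormedAddCommGroup H] [InnerProductSpace ℂ H] [CompleteSpace H]
  [NormedAddCommGroup K] [InnerProductSpace ℂ K] [CompleteSpace K]

/-- `(T ^ t)` extends the classical Markov semigroup `(P ^ t)`, with the observables `f` on `E`
embedded by `m` and the points of `E` represented by the states `ρ`. -/
def ExtendsSemigroup [Fintype E] [DecidableEq E] (P : Matrix E E ℝ)
    (T : Op H →ₗ[ℂ] Op H) (m : (E → ℂ) →⋆ₐ[ℂ] Op H)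
    (ρ : E → Op H) : Prop :=
  Function.Injective m ∧
  (∀ f : E → ℂ, T (m f) = m ((P.map Complex.ofReal).mulVec f)) ∧
  (∀ k, IsState (ρ k)) ∧
  ∀ (k : E) (f : E → ℂ) (t : ℕ),
    HasTrace ((T ^ t) (m f) * ρ k) (((P ^ t).map Complex.ofReal).mulVec f k)

/-- The dilation `(K, U, σ)` extends the classical dilation `(G^ℤ, α, Q)`: the continuous functions
on `E × G^ℤ` are embedded by `m` so that `U*ᵗ m_F Uᵗ = m_{F ∘ αᵗ}` for all `t ∈ ℤ`, and for all
`k` the joint distributions under `δ_k ⊗ Q` and under `ρ_k ⊗ σ` agree. -/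
def ExtendsDilation [TopologicalSpace E] [MeasurableSpace E] [TopologicalSpace G]
    [MeasurableSpace G]
    (α : (E × (ℤ → G)) ≃ₜ (E × (ℤ → G))) (Q : MeasureTheory.Measure (ℤ → G))
    (U : unitary (Op (HilbertTensor H K))) (σ : Op K)
    (m : C(E × (ℤ → G), ℂ) →⋆ₐ[ℂ] (Op (HilbertTensor H K)))
    (ρ : E → Op H) : Prop :=
  Function.Injective m ∧
  (∀ (F : C(E × (ℤ → G), ℂ)) (t : ℤ),
    conjBy (U ^ t) (m F) =
      m (F.comp ⟨⇑(α ^ t), (α ^ t).continuous⟩)) ∧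
  (∀ k, IsState (ρ k)) ∧
  ∀ (k : E) (n : ℕ) (F : Fin n → C(E × (ℤ → G), ℂ)) (η : (Fin n → ℂ) →ᵇ ℝ),
    ∃ B, IsJointCFC (fun i => m (F i)) ⟨fun z => (η z : ℂ), by fun_prop⟩ B ∧
      HasTrace (B * opTensor (ρ k) σ)
        ((∫ ω, η (fun i => F i ω) ∂((MeasureTheory.Measure.dirac k).prod Q) : ℝ) : ℂ)

end Extension

/-! ## The quantum dilation of the automaton -/

section Automaton

variable {E G : Type*} [Fintype E] [DecidableEq E] [Fintype G] [DecidableEq G]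

/-- The permutation unitary `V = ∑ |φ(i, g)⟩⟨i, g|` on `ℂ^E ⊗ ℂ^G`. -/
def permUnitary (φ : Equiv.Perm (E × G)) :
    unitary (Op (HilbertTensor (EuclideanSpace ℂ E) (EuclideanSpace ℂ G))) :=
  let b := (EuclideanSpace.basisFun E ℂ).tensorProduct (EuclideanSpace.basisFun G ℂ)
  Unitary.linearIsometryEquiv.symm (completionEquiv (b.equiv b φ))

/-- The vector `∑_β √q_β |e₀, β⟩`. -/
def inputVec (e₀ : E) (q : PMF (E → E)) : EuclideanSpace ℂ (Site E) :=
  ∑ β : E → E, (Real.sqrt (q β).toReal : ℂ) • EuclideanSpace.single ((e₀, β) : Site E) (1 : ℂ)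

lemma norm_inputVec (e₀ : E) (q : PMF (E → E)) : ‖inputVec e₀ q‖ = 1 := by
  have ho : Orthonormal ℂ
      (fun β : E → E => EuclideanSpace.single ((e₀, β) : Site E) (1 : ℂ)) :=
    (EuclideanSpace.orthonormal_single (𝕜 := ℂ) (ι := Site E)).comp (fun β : E → E => (e₀, β))
      (fun _ _ h => (Prod.mk.inj h).2)
  have hq : ∑ β : E → E, (q β).toReal = 1 := by
    rw [← ENNReal.toReal_sum fun β _ => q.apply_ne_top β, ← tsum_fintype (L := .unconditional _),
      q.tsum_coe, ENNReal.toReal_one]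
  have h2 : ((‖inputVec e₀ q‖ ^ 2 : ℝ) : ℂ) = 1 := by
    push_cast
    refine (inner_self_eq_norm_sq_to_K (𝕜 := ℂ) (inputVec e₀ q)).symm.trans ?_
    rw [inputVec, ho.inner_sum]
    simp only [Complex.conj_ofReal, ← Complex.ofReal_mul, Real.mul_self_sqrt ENNReal.toReal_nonneg]
    rw [← Complex.ofReal_sum, hq, Complex.ofReal_one]
  have h3 : ‖inputVec e₀ q‖ ^ 2 = 1 := by exact_mod_cast h2
  nlinarith [norm_nonneg (inputVec e₀ q)]

/-- The vector `∑_β √q_β |e₀, β⟩` as a unit vector. -/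
def inputUnit (e₀ : E) (q : PMF (E → E)) :
    Metric.sphere (0 : EuclideanSpace ℂ (Site E)) 1 :=
  ⟨inputVec e₀ q, by simp [norm_inputVec]⟩

end Automaton

end MarkovDilation

end

open MarkovDilation

/-!
The stochastic map is `T a = W* (a ⊗ 1) W` with `W h = V (h ⊗ φ)`. It is completely positive
because a basis of `ℂ^G` turns it into a Kraus sum, and unital because `W` is an isometry. Since
`V (|j⟩ ⊗ φ) = ∑_β √q_β |β j⟩ ⊗ |j, β⟩`, where the labels `(j, β)` are distinct, `T` maps the
diagonal operator of `f` to that of `P f` (`stinespringMap_diagOp`). The states `ρ_k` are the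
basis states.

Operators on `H ⊗ Z` are ampliated to `H ⊗ ⨂_ℤ Z`, with `Z` at any given place. For a unitary
operator the images prescribed on product vectors have the right inner products, so that an
extension exists; unitary operators span, and the ampliation is unique, so it is a unital
`*`-homomorphism (`amp`). In particular `V₁` is unitary. Let `M` be the closed span of the
vectors `h ⊗ ⨂ uₙ` with `uₙ = φ` for all `n ≥ 1`. The evolution `U = Θ V₁` maps `M` to itself, as
the place changed by `V₁` is shifted to `0`, and `U* (a ⊗ 1) U` and `T a ⊗ 1` have the same
matrix elements on `M` (`inner_evolution`). By iteration `U*ᵗ (a ⊗ 1) Uᵗ` and `Tᵗ a ⊗ 1` have the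
same matrix elements on `M`, which contains the vectors `h ⊗ Ψ`.

Functions of the system and functions of the `n`-th coordinate act by diagonal operators on the
factors. These representations commute, and by Gelfand duality they combine to a representation
`m` of `C(E × G^ℤ)` (`exists_joint_starAlgHom`). By the Stone-Weierstrass theorem, identities
between `*`-homomorphisms need only be checked for functions of one coordinate, and identities
between bounded linear maps for products of such functions. The first gives the covariance
`U* m_F U = m_{F ∘ α}`, which reduces to the fact that `V` permutes the basis of `ℂ^E ⊗ ℂ^G`; the
second gives `⟪k ⊗ Ψ, m_F (k ⊗ Ψ)⟫ = ∫ F d(δ_k ⊗ Q_P)`, because `|φ|²` is the distribution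
`δ_{e₀} ⊗ q`. The functional calculus of `m_{F₁}, …, m_{Fₙ}` is `η ↦ m_{η(F₁, …, Fₙ)}`.
-/

noncomputable section

namespace MarkovDilation

/-! ### Operators determined by their values on a total family -/

section Total

variable {ι X Y : Type*} [NormedAddCommGroup X] [InnerProductSpace ℂ X]
  [NormedAddCommGroup Y] [InnerProductSpace ℂ Y]

/-- A correspondence between a total family and another family which preserves inner products
extends to a bounded operator. -/
lemma exists_clm_of_inner_eq [CompleteSpace Y] (x : ι → X) (y : ι → Y)
    (hx : Dense (Submodule.span ℂ (Set.range x) : Set X))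
    (h : ∀ i j, ⟪y i, y j⟫_ℂ = ⟪x i, x j⟫_ℂ) : ∃ S : X →L[ℂ] Y, ∀ i, S (x i) = y i := by
  have hd : DenseRange (Finsupp.linearCombination ℂ x) := by
    have h1 : Set.range (Finsupp.linearCombination ℂ x) =
        (Submodule.span ℂ (Set.range x) : Set X) := by
      rw [← Finsupp.range_linearCombination]; rfl
    rw [DenseRange, h1]; exact hx
  have hin : ∀ c : ι →₀ ℂ, ⟪Finsupp.linearCombination ℂ y c, Finsupp.linearCombination ℂ y c⟫_ℂ =
      ⟪Finsupp.linearCombination ℂ x c, Finsupp.linearCombination ℂ x c⟫_ℂ := by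
    intro c
    simp only [Finsupp.linearCombination_apply, Finsupp.sum, sum_inner, inner_sum, inner_smul_left,
      inner_smul_right, h]
  have hn : ∀ c : ι →₀ ℂ, ‖Finsupp.linearCombination ℂ y c‖ ≤
      1 * ‖Finsupp.linearCombination ℂ x c‖ := by
    intro c
    rw [one_mul, @norm_eq_sqrt_re_inner ℂ, @norm_eq_sqrt_re_inner ℂ, hin]
  refine ⟨(Finsupp.linearCombination ℂ y).extendOfNorm (Finsupp.linearCombination ℂ x),
    fun i => ?_⟩
  have := LinearMap.extendOfNorm_eq (f := Finsupp.linearCombination ℂ y) hd ⟨1, hn⟩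
    (Finsupp.single i 1)
  simpa using this

lemma inner_map_eq_of_total (x : ι → X) (hx : Dense (Submodule.span ℂ (Set.range x) : Set X))
    (A B : X →L[ℂ] X) (h : ∀ i j, ⟪x i, A (x j)⟫_ℂ = ⟪x i, B (x j)⟫_ℂ) : A = B := by
  refine ContinuousLinearMap.ext_on hx ?_
  rintro _ ⟨j, rfl⟩
  refine hx.eq_of_inner_right (𝕜 := ℂ) fun v hv => ?_
  induction hv using Submodule.span_induction with
  | mem v hv => obtain ⟨i, rfl⟩ := hv; exact h i j
  | zero => simp
  | add a b _ _ ha hb => simp [inner_add_left, ha, hb]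
  | smul c a _ ha => simp [inner_smul_left, ha]

end Total

/-! ### Product vectors and operators `a ⊗ b` -/

section HilbertTensorLemmas

variable {H H' H'' K K' K'' : Type*}
  [NormedAddCommGroup H] [InnerProductSpace ℂ H] [NormedAddCommGroup H'] [InnerProductSpace ℂ H']
  [NormedAddCommGroup K] [InnerProductSpace ℂ K] [NormedAddCommGroup K'] [InnerProductSpace ℂ K']
  [NormedAddCommGroup H''] [InnerProductSpace ℂ H'']
  [NormedAddCommGroup K''] [InnerProductSpace ℂ K'']

lemma inner_vecTensor (h h' : H) (k k' : K) :
    ⟪vecTensor h k, vecTensor h' k'⟫_ℂ = ⟪h, h'⟫_ℂ * ⟪k, k'⟫_ℂ := by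
  rw [vecTensor, vecTensor, UniformSpace.Completion.inner_coe, TensorProduct.inner_tmul]

lemma vecTensor_add_left (h h' : H) (k : K) :
    vecTensor (h + h') k = vecTensor h k + vecTensor h' k := by
  rw [vecTensor, TensorProduct.add_tmul, UniformSpace.Completion.coe_add]; rfl

lemma vecTensor_add_right (h : H) (k k' : K) :
    vecTensor h (k + k') = vecTensor h k + vecTensor h k' := by
  rw [vecTensor, TensorProduct.tmul_add, UniformSpace.Completion.coe_add]; rfl

lemma vecTensor_smul_left (c : ℂ) (h : H) (k : K) :
    vecTensor (c • h) k = c • vecTensor h k := by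
  rw [vecTensor, ← TensorProduct.smul_tmul', UniformSpace.Completion.coe_smul]; rfl

lemma vecTensor_smul_right (c : ℂ) (h : H) (k : K) :
    vecTensor h (c • k) = c • vecTensor h k := by
  simp [vecTensor]

lemma norm_vecTensor (h : H) (k : K) : ‖vecTensor h k‖ = ‖h‖ * ‖k‖ := by
  rw [vecTensor, UniformSpace.Completion.norm_coe, TensorProduct.norm_tmul]

/-- `k ↦ h ⊗ k` as a bounded operator. -/
def tensorLeft (h : H) : K →L[ℂ] HilbertTensor H K :=
  LinearMap.mkContinuous
    { toFun := fun k => vecTensor h k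
      map_add' := vecTensor_add_right h
      map_smul' := fun c => vecTensor_smul_right c h } ‖h‖
    fun k => (norm_vecTensor h k).le

/-- `h ↦ h ⊗ k` as a bounded operator. -/
def tensorRight (k : K) : H →L[ℂ] HilbertTensor H K :=
  LinearMap.mkContinuous
    { toFun := fun h => vecTensor h k
      map_add' := fun h h' => vecTensor_add_left h h' k
      map_smul' := fun c h => vecTensor_smul_left c h k } ‖k‖
    fun h => ((norm_vecTensor h k).trans (mul_comm _ _)).le

@[simp] lemma tensorLeft_apply (h : H) (k : K) : tensorLeft h k = vecTensor h k := rfl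

@[simp] lemma tensorRight_apply (h : H) (k : K) : tensorRight k h = vecTensor h k := rfl

@[simp] lemma opTensor_vecTensor (a : H →L[ℂ] H') (b : K →L[ℂ] K') (h : H) (k : K) :
    opTensor a b (vecTensor h k) = vecTensor (a h) (b k) := by
  simp [opTensor, vecTensor]

lemma adjoint_tensorRight_vecTensor [CompleteSpace H] (k : K) (x : H) (y : K) :
    (tensorRight (H := H) k).adjoint (vecTensor x y) = ⟪k, y⟫_ℂ • x := by
  refine ext_inner_left ℂ fun v => ?_
  rw [ContinuousLinearMap.adjoint_inner_right, tensorRight_apply, inner_vecTensor,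
    inner_smul_right, mul_comm]

/-- Products of vectors from total families form a total family. -/
lemma dense_span_vecTensor {ι κ : Type*} {x : ι → H} {y : κ → K}
    (hx : Dense (Submodule.span ℂ (Set.range x) : Set H))
    (hy : Dense (Submodule.span ℂ (Set.range y) : Set K)) :
    Dense (Submodule.span ℂ (Set.range fun p : ι × κ => vecTensor (x p.1) (y p.2)) :
      Set (HilbertTensor H K)) := by
  set M := (Submodule.span ℂ (Set.range fun p : ι × κ => vecTensor (x p.1) (y p.2))) with hM
  rw [Submodule.dense_iff_topologicalClosure_eq_top]
  have h1 : ∀ i k, vecTensor (x i) k ∈ M.topologicalClosure := by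
    intro i k
    have : (Submodule.span ℂ (Set.range y)).topologicalClosure ≤
        M.topologicalClosure.comap (tensorLeft (K := K) (x i)).toLinearMap := by
      refine Submodule.topologicalClosure_minimal _ (Submodule.span_le.mpr ?_) ?_
      · rintro _ ⟨j, rfl⟩
        exact M.le_topologicalClosure (Submodule.subset_span ⟨(i, j), rfl⟩)
      · exact (Submodule.isClosed_topologicalClosure M).preimage
          (tensorLeft (K := K) (x i)).continuous
    rw [Submodule.dense_iff_topologicalClosure_eq_top.mp hy] at this
    exact this (Submodule.mem_top (x := k))
  have h2 : ∀ h k, vecTensor h k ∈ M.topologicalClosure := by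
    intro h k
    have : (Submodule.span ℂ (Set.range x)).topologicalClosure ≤
        M.topologicalClosure.comap (tensorRight (H := H) k).toLinearMap := by
      refine Submodule.topologicalClosure_minimal _ (Submodule.span_le.mpr ?_) ?_
      · rintro _ ⟨j, rfl⟩
        exact h1 j k
      · exact (Submodule.isClosed_topologicalClosure M).preimage
          (tensorRight (H := H) k).continuous
    rw [Submodule.dense_iff_topologicalClosure_eq_top.mp hx] at this
    exact this (Submodule.mem_top (x := h))
  rw [Submodule.eq_top_iff']
  intro z
  induction z using UniformSpace.Completion.induction_on with
  | hp => exact Submodule.isClosed_topologicalClosure M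
  | ih z =>
    induction z using TensorProduct.induction_on with
    | zero => exact zero_mem _
    | tmul h k => exact h2 h k
    | add a b ha hb =>
      rw [UniformSpace.Completion.coe_add]
      exact add_mem ha hb

lemma dense_span_vecTensor_univ :
    Dense (Submodule.span ℂ (Set.range fun p : H × K => vecTensor p.1 p.2) :
      Set (HilbertTensor H K)) :=
  dense_span_vecTensor (x := id) (y := id) (by simp) (by simp)

lemma ext_vecTensor {F : Type*} [NormedAddCommGroup F] [NormedSpace ℂ F]
    {A B : HilbertTensor H K →L[ℂ] F}
    (h : ∀ x y, A (vecTensor x y) = B (vecTensor x y)) : A = B := by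
  refine ContinuousLinearMap.ext_on dense_span_vecTensor_univ ?_
  rintro _ ⟨p, rfl⟩
  exact h _ _

lemma opTensor_comp (a : H' →L[ℂ] H'') (b : K' →L[ℂ] K'') (a' : H →L[ℂ] H') (b' : K →L[ℂ] K') :
    opTensor a b ∘L opTensor a' b' = opTensor (a ∘L a') (b ∘L b') :=
  ext_vecTensor fun x y => by simp

lemma opTensor_mul (a a' : H →L[ℂ] H) (b b' : K →L[ℂ] K) :
    opTensor a b * opTensor a' b' = opTensor (a * a') (b * b') :=
  opTensor_comp _ _ _ _

lemma opTensor_one : opTensor (1 : H →L[ℂ] H) (1 : K →L[ℂ] K) = 1 :=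
  ext_vecTensor fun x y => by simp

lemma opTensor_add_left (a a' : H →L[ℂ] H') (b : K →L[ℂ] K') :
    opTensor (a + a') b = opTensor a b + opTensor a' b :=
  ext_vecTensor fun x y => by simp [vecTensor_add_left]

lemma opTensor_add_right (a : H →L[ℂ] H') (b b' : K →L[ℂ] K') :
    opTensor a (b + b') = opTensor a b + opTensor a b' :=
  ext_vecTensor fun x y => by simp [vecTensor_add_right]

lemma opTensor_smul_left (c : ℂ) (a : H →L[ℂ] H') (b : K →L[ℂ] K') :
    opTensor (c • a) b = c • opTensor a b :=
  ext_vecTensor fun x y => by simp [vecTensor_smul_left]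

lemma opTensor_smul_right (c : ℂ) (a : H →L[ℂ] H') (b : K →L[ℂ] K') :
    opTensor a (c • b) = c • opTensor a b :=
  ext_vecTensor fun x y => by simp [vecTensor_smul_right]

variable [CompleteSpace H] [CompleteSpace K] [CompleteSpace H'] [CompleteSpace K']

lemma adjoint_opTensor (a : H →L[ℂ] H') (b : K →L[ℂ] K') :
    (opTensor a b).adjoint = opTensor a.adjoint b.adjoint := by
  refine ext_vecTensor fun x y => ?_
  refine dense_span_vecTensor_univ.eq_of_inner_right (𝕜 := ℂ) fun v hv => ?_
  induction hv using Submodule.span_induction with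
  | mem v hv =>
    obtain ⟨p, rfl⟩ := hv
    simp [ContinuousLinearMap.adjoint_inner_right, inner_vecTensor]
  | zero => simp
  | add a b _ _ ha hb => simp only [inner_add_left, ha, hb]
  | smul c a _ ha => simp only [inner_smul_left, ha]

lemma star_opTensor (a : Op H) (b : Op K) : star (opTensor a b) = opTensor (star a) (star b) :=
  adjoint_opTensor a b

/-- The embedding `b ↦ 1 ⊗ b`. -/
def ampRight : Op K →⋆ₐ[ℂ] Op (HilbertTensor H K) where
  toFun b := opTensor 1 b
  map_one' := opTensor_one
  map_mul' b b' := by rw [opTensor_mul, one_mul]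
  map_zero' := by simpa using opTensor_smul_right 0 (1 : Op H) (0 : Op K)
  map_add' := opTensor_add_right _
  commutes' c := by
    rw [Algebra.algebraMap_eq_smul_one, Algebra.algebraMap_eq_smul_one, opTensor_smul_right,
      opTensor_one]
  map_star' b := by rw [star_opTensor, star_one]

/-- The embedding `a ↦ a ⊗ 1`. -/
def ampLeft : Op H →⋆ₐ[ℂ] Op (HilbertTensor H K) where
  toFun a := opTensor a 1
  map_one' := opTensor_one
  map_mul' b b' := by rw [opTensor_mul, one_mul]
  map_zero' := by simpa using opTensor_smul_left 0 (0 : Op H) (1 : Op K)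
  map_add' a a' := opTensor_add_left a a' _
  commutes' c := by
    rw [Algebra.algebraMap_eq_smul_one, Algebra.algebraMap_eq_smul_one, opTensor_smul_left,
      opTensor_one]
  map_star' b := by rw [star_opTensor, star_one]

end HilbertTensorLemmas

/-! ### Traces and conditional expectations for vector states -/

section Trace

variable {H K : Type*}
  [NormedAddCommGroup H] [InnerProductSpace ℂ H]
  [NormedAddCommGroup K] [InnerProductSpace ℂ K]

lemma hasTrace_rankOne (x y : H) : HasTrace (InnerProductSpace.rankOne ℂ x y) ⟪y, x⟫_ℂ := by
  intro S b
  simpa [inner_smul_right, mul_comm] using b.hasSum_inner_mul_inner y x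

lemma hasTrace_sum {ι : Type*} (s : Finset ι) {A : ι → Op H} {c : ι → ℂ}
    (h : ∀ i ∈ s, HasTrace (A i) (c i)) : HasTrace (∑ i ∈ s, A i) (∑ i ∈ s, c i) := by
  intro S b
  simpa [inner_sum] using hasSum_sum fun i hi => h i hi S b

lemma isState_pureState {h : H} (hh : ‖h‖ = 1) : IsState (pureState h) := by
  refine ⟨?_, ?_⟩
  · rw [ContinuousLinearMap.nonneg_iff_isPositive]
    exact InnerProductSpace.isPositive_rankOne_self h
  · have := hasTrace_rankOne h h
    rwa [inner_self_eq_norm_sq_to_K, hh, RCLike.ofReal_one, one_pow] at this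

lemma hasTrace_mul_pureState (A : Op H) (h : H) : HasTrace (A * pureState h) ⟪h, A h⟫_ℂ := by
  have : A * pureState h = InnerProductSpace.rankOne ℂ (A h) h := by
    ext z; simp [pureState]
  rw [this]
  exact hasTrace_rankOne _ _

lemma opTensor_pureState (h : H) (k : K) :
    opTensor (pureState h) (pureState k) = pureState (vecTensor h k) :=
  ext_vecTensor fun x y => by
    simp [pureState, inner_vecTensor, vecTensor_smul_left, vecTensor_smul_right, smul_smul,
      mul_comm]

variable [CompleteSpace H]

/-- An operator factoring through a finite dimensional space is trace class. -/
lemma hasTrace_comp_adjoint [CompleteSpace K] {ι : Type*} [Fintype ι] (e : OrthonormalBasis ι ℂ H)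
    (C D : H →L[ℂ] K) : HasTrace (C ∘L D.adjoint) (∑ i, ⟪D (e i), C (e i)⟫_ℂ) := by
  have h : C ∘L D.adjoint = ∑ i, InnerProductSpace.rankOne ℂ (C (e i)) (D (e i)) := by
    ext z
    simp only [ContinuousLinearMap.comp_apply, sum_apply,
      InnerProductSpace.rankOne_apply]
    rw [← e.sum_repr' (D.adjoint z)]
    simp [ContinuousLinearMap.adjoint_inner_right]
  rw [h]
  exact hasTrace_sum _ fun i _ => hasTrace_rankOne _ _

/-- For a vector state `σ = |k⟩⟨k|`, the conditional expectation of `A` is the compression of `A`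
to the vectors `h ⊗ k`. -/
lemma isCondExp_pureState {ι : Type*} [Fintype ι] (e : OrthonormalBasis ι ℂ H)
    {k : K} {A : Op (HilbertTensor H K)} {B : Op H}
    (hB : ∀ h h' : H, ⟪h, B h'⟫_ℂ = ⟪vecTensor h k, A (vecTensor h' k)⟫_ℂ) :
    IsCondExp (pureState k) A B := by
  intro ρ _
  refine ⟨∑ i, ⟪e i, B (ρ (e i))⟫_ℂ, ?_, ?_⟩
  · have := hasTrace_comp_adjoint e (B ∘L ρ) (ContinuousLinearMap.id ℂ H)
    rwa [ContinuousLinearMap.adjoint_id, ContinuousLinearMap.comp_id] at this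
  · have := hasTrace_comp_adjoint e (A ∘L tensorRight k ∘L ρ) (tensorRight k)
    convert this using 1
    · rw [ContinuousLinearMap.mul_def, ContinuousLinearMap.comp_assoc]
      congr 1
      refine ext_vecTensor fun x y => ?_
      simp [adjoint_tensorRight_vecTensor, pureState, vecTensor_smul_right]
    · exact Finset.sum_congr rfl fun i _ => hB _ _

end Trace

/-! ### Families agreeing with the stabilizing family -/

section Families

variable {ι Z : Type*} [NormedAddCommGroup Z] {ψ : ι → Metric.sphere (0 : Z) 1}

@[ext] lemma StabFamily.ext {u v : StabFamily ψ} (h : ∀ n, u.vec n = v.vec n) : u = v := by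
  cases u; cases v; congr; exact funext h

@[simp] lemma StabFamily.update_vec_self (u : StabFamily ψ) (n : ι) (w : Z) :
    (u.update n w).vec n = w := by
  simp [StabFamily.update]

lemma StabFamily.update_vec_of_ne (u : StabFamily ψ) {n m : ι} (h : m ≠ n) (w : Z) :
    (u.update n w).vec m = u.vec m := by
  simp [StabFamily.update, h]

@[simp] lemma StabFamily.update_eq_self (u : StabFamily ψ) (n : ι) : u.update n (u.vec n) = u := by
  ext m
  by_cases h : m = n
  · subst h; simp
  · rw [update_vec_of_ne _ h]

@[simp] lemma StabFamily.update_idem (u : StabFamily ψ) (n : ι) (w w' : Z) :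
    (u.update n w).update n w' = u.update n w' := by
  ext m
  by_cases h : m = n
  · subst h; simp
  · simp [update_vec_of_ne _ h]

lemma StabFamily.update_comm (u : StabFamily ψ) {n m : ι} (h : n ≠ m) (w w' : Z) :
    (u.update n w).update m w' = (u.update m w').update n w := by
  ext k
  by_cases h1 : k = m
  · subst h1; simp [update_vec_of_ne _ h.symm]
  · by_cases h2 : k = n
    · subst h2; simp [update_vec_of_ne _ h1]
    · simp [update_vec_of_ne _ h1, update_vec_of_ne _ h2]

end Families

/-! ### Product vectors of the infinite tensor product -/

section ProductVectors

variable {ι Z : Type*} [NormedAddCommGroup Z] [InnerProductSpace ℂ Z]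
  (ψ : ι → Metric.sphere (0 : Z) 1)

lemma dense_span_tprod : Dense (Submodule.span ℂ (Set.range (tprod ψ)) : Set (InfTensor ψ)) := by
  have h := RKHS.kerFun_dense (𝕜 := ℂ) (H := InfTensor ψ)
  rw [← Submodule.dense_iff_topologicalClosure_eq_top] at h
  refine h.mono (Submodule.span_le.mpr ?_)
  rintro _ ⟨u, v, rfl⟩
  have : RKHS.kerFun (InfTensor ψ) u v = v • tprod ψ u := by
    rw [tprod, ← map_smul, smul_eq_mul, mul_one]
  rw [this]
  exact Submodule.smul_mem _ _ (Submodule.subset_span ⟨u, rfl⟩)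

lemma siteMap_apply (u : StabFamily ψ) (n : ι) (w : Z) :
    siteMap ψ u n w = tprod ψ (u.update n w) := rfl

lemma siteMap_update (u : StabFamily ψ) (n : ι) (w : Z) :
    siteMap ψ (u.update n w) n = siteMap ψ u n := by
  ext1 w'
  rw [siteMap_apply, siteMap_apply, StabFamily.update_idem]

lemma inner_siteMap (u v : StabFamily ψ) (n : ι) (w w' : Z) :
    ⟪siteMap ψ u n w, siteMap ψ v n w'⟫_ℂ =
      (∏ᶠ (m : ι) (_ : m ≠ n), ⟪u.vec m, v.vec m⟫_ℂ) * ⟪w, w'⟫_ℂ := by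
  rw [siteMap_apply, siteMap_apply, inner_tprod]
  refine (stabKernel_update_right ψ (u.update n w) v n w').trans ?_
  rw [mul_comm, StabFamily.update_vec_self]
  congr 1
  exact finprod_congr fun m => finprod_congr fun hm => by rw [StabFamily.update_vec_of_ne _ hm]

end ProductVectors

/-! ### Ampliation to the infinite tensor product -/

section Ampliation

variable {ι H Z : Type*} [NormedAddCommGroup Z] [InnerProductSpace ℂ Z]
  [NormedAddCommGroup H] [InnerProductSpace ℂ H]
  (ψ : ι → Metric.sphere (0 : Z) 1)

lemma dense_span_vecTensor_tprod :
    Dense (Submodule.span ℂ (Set.range fun p : H × StabFamily ψ => vecTensor p.1 (tprod ψ p.2)) :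
      Set (HilbertTensor H (InfTensor ψ))) :=
  dense_span_vecTensor (x := id) (by simp) (dense_span_tprod ψ)

variable {ψ} in
lemma ext_vecTensor_tprod {F : Type*} [NormedAddCommGroup F] [NormedSpace ℂ F]
    {A B : HilbertTensor H (InfTensor ψ) →L[ℂ] F}
    (h : ∀ x u, A (vecTensor x (tprod ψ u)) = B (vecTensor x (tprod ψ u))) : A = B := by
  refine ContinuousLinearMap.ext_on (dense_span_vecTensor_tprod ψ) ?_
  rintro _ ⟨p, rfl⟩
  exact h _ _

/-- The embedding of `H ⊗ Z` at the `n`-th place, completed by the vectors of `u` at the other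
places. -/
def siteEmb (H : Type*) [NormedAddCommGroup H] [InnerProductSpace ℂ H]
    (u : StabFamily ψ) (n : ι) : HilbertTensor H Z →L[ℂ] HilbertTensor H (InfTensor ψ) :=
  opTensor (ContinuousLinearMap.id ℂ H) (siteMap ψ u n)

@[simp] lemma siteEmb_vecTensor (u : StabFamily ψ) (n : ι) (h : H) (w : Z) :
    siteEmb ψ H u n (vecTensor h w) = vecTensor h (tprod ψ (u.update n w)) := by
  simp [siteEmb, siteMap_apply]

lemma siteEmb_update (u : StabFamily ψ) (n : ι) (w : Z) :
    siteEmb ψ H (u.update n w) n = siteEmb ψ H u n := by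
  rw [siteEmb, siteMap_update, siteEmb]

lemma isAmpliation_iff {n : ι} {Y : Op (HilbertTensor H Z)}
    {X : Op (HilbertTensor H (InfTensor ψ))} :
    IsAmpliation ψ n Y X ↔ ∀ u x, X (siteEmb ψ H u n x) = siteEmb ψ H u n (Y x) := by
  simp only [IsAmpliation, ContinuousLinearMap.ext_iff, ContinuousLinearMap.comp_apply, siteEmb]

lemma isAmpliation_iff_vecTensor {n : ι} {Y : Op (HilbertTensor H Z)}
    {X : Op (HilbertTensor H (InfTensor ψ))} :
    IsAmpliation ψ n Y X ↔
      ∀ h u, X (vecTensor h (tprod ψ u)) = siteEmb ψ H u n (Y (vecTensor h (u.vec n))) := by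
  rw [isAmpliation_iff]
  refine ⟨fun hX h u => ?_, fun hX u x => ?_⟩
  · rw [← hX, siteEmb_vecTensor, StabFamily.update_eq_self]
  · have : X ∘L siteEmb ψ H u n = siteEmb ψ H u n ∘L Y := by
      refine ext_vecTensor fun h w => ?_
      simp [hX, siteEmb_update]
    exact DFunLike.congr_fun this x

variable {ψ} in
lemma IsAmpliation.unique {n : ι} {Y : Op (HilbertTensor H Z)}
    {X X' : Op (HilbertTensor H (InfTensor ψ))} (h : IsAmpliation ψ n Y X)
    (h' : IsAmpliation ψ n Y X') : X = X' := by
  rw [isAmpliation_iff_vecTensor] at h h'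
  exact ext_vecTensor_tprod fun x u => by rw [h, h']

variable [CompleteSpace H] [CompleteSpace Z]

lemma inner_siteEmb (u v : StabFamily ψ) (n : ι) (x y : HilbertTensor H Z) :
    ⟪siteEmb ψ H u n x, siteEmb ψ H v n y⟫_ℂ =
      (∏ᶠ (m : ι) (_ : m ≠ n), ⟪u.vec m, v.vec m⟫_ℂ) * ⟪x, y⟫_ℂ := by
  have h1 : (siteMap ψ u n).adjoint ∘L siteMap ψ v n =
      (∏ᶠ (m : ι) (_ : m ≠ n), ⟪u.vec m, v.vec m⟫_ℂ) • 1 := by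
    ext1 w
    refine ext_inner_left ℂ fun w' => ?_
    rw [ContinuousLinearMap.comp_apply, ContinuousLinearMap.adjoint_inner_right, inner_siteMap]
    simp [inner_smul_right]
  have h2 : (siteEmb ψ H u n).adjoint ∘L siteEmb ψ H v n =
      (∏ᶠ (m : ι) (_ : m ≠ n), ⟪u.vec m, v.vec m⟫_ℂ) • 1 := by
    rw [siteEmb, siteEmb, adjoint_opTensor, opTensor_comp, h1, opTensor_smul_right]
    congr 1
    exact ext_vecTensor fun h w => by
      rw [opTensor_vecTensor, ContinuousLinearMap.adjoint_id]; rfl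
  rw [← ContinuousLinearMap.adjoint_inner_right, ← ContinuousLinearMap.comp_apply, h2]
  simp [inner_smul_right]

/-- For unitary `Y` the prescribed images of the product vectors have the same inner products as the
product vectors; the general case follows, as the unitary operators span. -/
lemma exists_isAmpliation (n : ι) (Y : Op (HilbertTensor H Z)) :
    ∃ X, IsAmpliation ψ n Y X := by
  have hY : Y ∈ Submodule.span ℂ (unitary (Op (HilbertTensor H Z)) : Set _) := by
    rw [CStarAlgebra.span_unitary]; trivial
  simp only [isAmpliation_iff_vecTensor]
  induction hY using Submodule.span_induction with
  | mem Y hY =>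
    obtain ⟨S, hS⟩ := exists_clm_of_inner_eq
      (fun p : H × StabFamily ψ => vecTensor p.1 (tprod ψ p.2))
      (fun p => siteEmb ψ H p.2 n (Y (vecTensor p.1 (p.2.vec n))))
      (dense_span_vecTensor_tprod ψ) fun p p' => by
        have h1 : ∀ p : H × StabFamily ψ,
            vecTensor p.1 (tprod ψ p.2) = siteEmb ψ H p.2 n (vecTensor p.1 (p.2.vec n)) :=
          fun p => by simp
        have h2 : ∀ x y, ⟪Y x, Y y⟫_ℂ = ⟪x, y⟫_ℂ := fun x y => by
          rw [← ContinuousLinearMap.adjoint_inner_right, ← ContinuousLinearMap.comp_apply]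
          have := (Unitary.mem_iff.mp hY).1
          rw [ContinuousLinearMap.star_eq_adjoint, ContinuousLinearMap.mul_def] at this
          rw [this]; rfl
        rw [h1, h1, inner_siteEmb, inner_siteEmb, h2]
    exact ⟨S, fun h u => hS (h, u)⟩
  | zero => exact ⟨0, by simp⟩
  | add Y Y' _ _ h h' =>
    obtain ⟨X, hX⟩ := h
    obtain ⟨X', hX'⟩ := h'
    exact ⟨X + X', by simp [hX, hX']⟩
  | smul c Y _ h =>
    obtain ⟨X, hX⟩ := h
    exact ⟨c • X, by simp [hX]⟩

variable {ψ} in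
lemma IsAmpliation.star {n : ι} {Y : Op (HilbertTensor H Z)}
    {X : Op (HilbertTensor H (InfTensor ψ))} (h : IsAmpliation ψ n Y X) :
    IsAmpliation ψ n (star Y) (star X) := by
  obtain ⟨X', hX'⟩ := exists_isAmpliation ψ n (Star.star Y)
  convert hX'
  rw [isAmpliation_iff_vecTensor] at h hX'
  refine inner_map_eq_of_total _ (dense_span_vecTensor_tprod (H := H) ψ) _ _ fun p p' => ?_
  have h1 : ∀ p : H × StabFamily ψ,
      vecTensor p.1 (tprod ψ p.2) = siteEmb ψ H p.2 n (vecTensor p.1 (p.2.vec n)) :=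
    fun p => by simp
  rw [ContinuousLinearMap.star_eq_adjoint, ContinuousLinearMap.adjoint_inner_right, h, hX',
    h1, h1, inner_siteEmb, inner_siteEmb, ContinuousLinearMap.star_eq_adjoint,
    ContinuousLinearMap.adjoint_inner_right]

/-- The ampliation of operators on `H ⊗ Z`, with `Z` at the `n`-th place. -/
def amp (n : ι) : Op (HilbertTensor H Z) →⋆ₐ[ℂ] Op (HilbertTensor H (InfTensor ψ)) :=
  have hs := fun Y => (exists_isAmpliation ψ n Y).choose_spec
  have hs' := fun Y => (isAmpliation_iff ψ).mp (hs Y)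
  have h1 : (exists_isAmpliation ψ n (1 : Op (HilbertTensor H Z))).choose = 1 :=
    (hs 1).unique ((isAmpliation_iff ψ).mpr fun u x => by simp)
  { toFun := fun Y => (exists_isAmpliation ψ n Y).choose
    map_one' := h1
    map_mul' := fun Y Y' => (hs _).unique ((isAmpliation_iff ψ).mpr fun u x => by simp [hs'])
    map_zero' := (hs _).unique ((isAmpliation_iff ψ).mpr fun u x => by simp)
    map_add' := fun Y Y' => (hs _).unique ((isAmpliation_iff ψ).mpr fun u x => by simp [hs'])
    commutes' := fun c => (hs _).unique ((isAmpliation_iff ψ).mpr fun u x => by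
      simp [Algebra.algebraMap_eq_smul_one])
    map_star' := fun Y => (hs _).unique (hs Y).star }

lemma isAmpliation_amp (n : ι) (Y : Op (HilbertTensor H Z)) : IsAmpliation ψ n Y (amp ψ n Y) :=
  (exists_isAmpliation ψ n Y).choose_spec

lemma amp_siteEmb (n : ι) (Y : Op (HilbertTensor H Z)) (u : StabFamily ψ)
    (x : HilbertTensor H Z) : amp ψ n Y (siteEmb ψ H u n x) = siteEmb ψ H u n (Y x) :=
  (isAmpliation_iff ψ).mp (isAmpliation_amp ψ n Y) u x

lemma amp_vecTensor (n : ι) (Y : Op (HilbertTensor H Z)) (h : H) (u : StabFamily ψ) :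
    amp ψ n Y (vecTensor h (tprod ψ u)) = siteEmb ψ H u n (Y (vecTensor h (u.vec n))) :=
  (isAmpliation_iff_vecTensor ψ).mp (isAmpliation_amp ψ n Y) h u

lemma amp_opTensor_vecTensor (n : ι) (a : Op H) (b : Op Z) (h : H) (u : StabFamily ψ) :
    amp ψ n (opTensor a b) (vecTensor h (tprod ψ u)) =
      vecTensor (a h) (tprod ψ (u.update n (b (u.vec n)))) := by
  simp [amp_vecTensor]

lemma amp_opTensor_one (n : ι) (a : Op H) : amp ψ n (opTensor a (1 : Op Z)) = opTensor a 1 :=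
  ext_vecTensor_tprod fun h u => by simp [amp_opTensor_vecTensor]

/-- Operators on `Z` at different places commute, also if one of them acts on `H` as well. -/
lemma commute_amp {n m : ι} (hnm : n ≠ m) (Y : Op (HilbertTensor H Z)) (b : Op Z) :
    Commute (amp ψ n Y) (amp ψ m (opTensor 1 b)) := by
  refine ext_vecTensor_tprod fun h u => ?_
  have h1 : amp ψ m (opTensor (1 : Op H) b) ∘L siteEmb ψ H u n =
      siteEmb ψ H (u.update m (b (u.vec m))) n := by
    refine ext_vecTensor fun x w => ?_
    rw [ContinuousLinearMap.comp_apply, siteEmb_vecTensor, amp_opTensor_vecTensor,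
      siteEmb_vecTensor, StabFamily.update_comm _ hnm, StabFamily.update_vec_of_ne _ hnm.symm]
    rfl
  rw [mul_apply_eq_comp, mul_apply_eq_comp, amp_opTensor_vecTensor,
    amp_vecTensor, amp_vecTensor, StabFamily.update_vec_of_ne _ hnm, ← h1]
  rfl

end Ampliation

/-! ### The shift -/

section Shift

variable {Z : Type*} [NormedAddCommGroup Z] (φ : Metric.sphere (0 : Z) 1)

lemma StabFamily.shift_vec (u : StabFamily fun _ : ℤ => φ) (n : ℤ) :
    u.shift.vec n = u.vec (n + 1) := rfl

/-- The inverse of the shift of families. -/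
def StabFamily.unshift (u : StabFamily (fun _ : ℤ => φ)) : StabFamily (fun _ : ℤ => φ) :=
  ⟨fun n => u.vec (n - 1), u.finite_ne.preimage (sub_left_injective (b := (1 : ℤ))).injOn⟩

lemma StabFamily.shift_unshift (u : StabFamily (fun _ : ℤ => φ)) : u.unshift.shift = u := by
  ext n; simp [shift, unshift]

lemma StabFamily.shift_update (u : StabFamily (fun _ : ℤ => φ)) (n : ℤ) (w : Z) :
    (u.update (n + 1) w).shift = u.shift.update n w := by
  ext m
  by_cases h : m = n
  · subst h; simp [shift_vec]
  · rw [shift_vec, update_vec_of_ne _ (by simpa using h), update_vec_of_ne _ h, shift_vec]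

variable [InnerProductSpace ℂ Z]
variable {H : Type*} [NormedAddCommGroup H] [InnerProductSpace ℂ H]

variable (H) in
/-- The shift on `H ⊗ ⨂_ℤ Z` exists as a unitary operator. -/
lemma exists_isShift [CompleteSpace H] : ∃ Θ : unitary (Op (HilbertTensor H (StabTensor φ))),
    IsShift φ (Θ : Op (HilbertTensor H (StabTensor φ))) := by
  have hd := dense_span_vecTensor_tprod (H := H) (fun _ : ℤ => φ)
  have hin : ∀ u v : StabFamily (fun _ : ℤ => φ),
      ⟪tprod _ u.shift, tprod _ v.shift⟫_ℂ = ⟪tprod _ u, tprod _ v⟫_ℂ := fun u v => by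
    rw [inner_tprod, inner_tprod]
    exact finprod_eq_of_bijective (fun n : ℤ => n + 1) (Equiv.addRight (1 : ℤ)).bijective
      fun n => rfl
  obtain ⟨S, hS⟩ := exists_clm_of_inner_eq _
    (fun p : H × StabFamily (fun _ : ℤ => φ) => vecTensor p.1 (tprod _ p.2.shift)) hd fun p p' => by
      rw [inner_vecTensor, inner_vecTensor, hin]
  obtain ⟨R, hR⟩ := exists_clm_of_inner_eq _
    (fun p : H × StabFamily (fun _ : ℤ => φ) => vecTensor p.1 (tprod _ p.2.unshift)) hd
      fun p p' => by
      rw [inner_vecTensor, inner_vecTensor, ← hin, StabFamily.shift_unshift,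
        StabFamily.shift_unshift]
  have hSR : S * R = 1 := ext_vecTensor_tprod fun h u => by
    have := hS (h, u.unshift)
    rw [mul_apply_eq_comp, hR (h, u), this]
    simp [StabFamily.shift_unshift]
  have hstar : star S * S = 1 := by
    refine inner_map_eq_of_total _ hd _ _ fun p p' => ?_
    rw [mul_apply_eq_comp, ContinuousLinearMap.star_eq_adjoint,
      ContinuousLinearMap.adjoint_inner_right, hS p, hS p', inner_vecTensor, hin,
      ← inner_vecTensor]
    rfl
  have hRS : R = star S := by rw [← one_mul R, ← hstar, mul_assoc, hSR, mul_one]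
  exact ⟨⟨S, Unitary.mem_iff.mpr ⟨hstar, hRS ▸ hSR⟩⟩, fun h u => hS (h, u)⟩

variable {φ}

lemma IsShift.map_siteEmb {Θ : Op (HilbertTensor H (StabTensor φ))} (hΘ : IsShift φ Θ)
    (u : StabFamily fun _ : ℤ => φ) (n : ℤ) (x : HilbertTensor H Z) :
    Θ (siteEmb (fun _ : ℤ => φ) H u (n + 1) x) = siteEmb _ H u.shift n x := by
  have h1 : Θ ∘L siteEmb (fun _ : ℤ => φ) H u (n + 1) =
      siteEmb (fun _ : ℤ => φ) H u.shift n := by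
    refine ext_vecTensor fun x w => ?_
    rw [ContinuousLinearMap.comp_apply, siteEmb_vecTensor, hΘ, siteEmb_vecTensor,
      StabFamily.shift_update]
  exact DFunLike.congr_fun h1 x

variable [CompleteSpace H] [CompleteSpace Z]

/-- The shift moves an operator from the place `n + 1` to the place `n`. -/
lemma IsShift.mul_amp {Θ : Op (HilbertTensor H (StabTensor φ))} (hΘ : IsShift φ Θ)
    (n : ℤ) (Y : Op (HilbertTensor H Z)) :
    amp (fun _ : ℤ => φ) n Y * Θ = Θ * amp (fun _ : ℤ => φ) (n + 1) Y := by
  refine ext_vecTensor_tprod fun h u => ?_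
  rw [mul_apply_eq_comp, mul_apply_eq_comp, amp_vecTensor, hΘ,
    amp_vecTensor, hΘ.map_siteEmb, StabFamily.shift_vec]

end Shift

/-! ### Functions on a product space and commuting `*`-homomorphisms -/

section JointHom

variable {ι X Y : Type*} [TopologicalSpace X] [TopologicalSpace Y]

/-- A continuous function on `X`, as a function on `X × Y^ι`. -/
def sysFun (f : C(X, ℂ)) : C(X × (ι → Y), ℂ) := f.comp ⟨fun x => x.1, continuous_fst⟩

/-- A continuous function on `Y`, as a function of the `i`-th coordinate on `X × Y^ι`. -/
def coordFun (i : ι) (f : C(Y, ℂ)) : C(X × (ι → Y), ℂ) :=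
  f.comp ⟨fun x => x.2 i, (continuous_apply i).comp continuous_snd⟩

@[simp] lemma sysFun_apply (f : C(X, ℂ)) (x : X × (ι → Y)) : sysFun f x = f x.1 := rfl

@[simp] lemma coordFun_apply (i : ι) (f : C(Y, ℂ)) (x : X × (ι → Y)) :
    coordFun i f x = f (x.2 i) := rfl

variable [CompactSpace X] [T2Space X] [CompactSpace Y] [T2Space Y]

open WeakDual.CharacterSpace in
/-- Unital `*`-homomorphisms on `C(X)` and `C(Y)` with commuting ranges combine to one on
`C(X × Y^ι)`: by Gelfand duality the commutative C*-algebra `B` which they generate is `C(Σ)`, its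
characters restrict to points of `X` and `Y`, and functions on `X × Y^ι` are pulled back along the
resulting map `Σ → X × Y^ι`. -/
theorem exists_joint_starAlgHom {A : Type*} [CStarAlgebra A]
    (π₀ : C(X, ℂ) →⋆ₐ[ℂ] A) (π : ι → C(Y, ℂ) →⋆ₐ[ℂ] A)
    (h₀ : ∀ i f g, Commute (π₀ f) (π i g))
    (hπ : ∀ i j, i ≠ j → ∀ f g, Commute (π i f) (π j g)) :
    ∃ m : C(X × (ι → Y), ℂ) →⋆ₐ[ℂ] A,
      (∀ f, m (sysFun f) = π₀ f) ∧ ∀ i f, m (coordFun i f) = π i f := by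
  let S : Set A := Set.range π₀ ∪ ⋃ i, Set.range (π i)
  let B := (StarAlgebra.adjoin ℂ S).topologicalClosure
  have hS : ∀ a ∈ S, ∀ b ∈ S, a * b = b * a := by
    rintro a (⟨f, rfl⟩ | ha) b (⟨g, rfl⟩ | hb)
    · exact (Commute.all f g).map π₀
    · obtain ⟨j, g, rfl⟩ := Set.mem_iUnion.mp hb
      exact h₀ j f g
    · obtain ⟨i, f, rfl⟩ := Set.mem_iUnion.mp ha
      exact (h₀ i g f).symm
    · obtain ⟨i, f, rfl⟩ := Set.mem_iUnion.mp ha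
      obtain ⟨j, g, rfl⟩ := Set.mem_iUnion.mp hb
      by_cases hij : i = j
      · subst hij
        exact (Commute.all f g).map (π i)
      · exact hπ i j hij f g
  have hstar : ∀ b ∈ S, star b ∈ S := by
    rintro b (⟨g, rfl⟩ | hb)
    · exact Or.inl ⟨star g, map_star π₀ g⟩
    · obtain ⟨j, g, rfl⟩ := Set.mem_iUnion.mp hb
      exact Or.inr (Set.mem_iUnion.mpr ⟨j, star g, map_star (π j) g⟩)
  have : IsMulCommutative (StarAlgebra.adjoin ℂ S) :=
    StarAlgebra.isMulCommutative_adjoin ℂ hS fun a ha b hb => hS a ha _ (hstar b hb)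
  have hcomm : ∀ a b : B, a * b = b * a :=
    (StarSubalgebra.commRingTopologicalClosure (StarAlgebra.adjoin ℂ S)
      (fun a b => mul_comm' a b)).mul_comm
  have hclosed : IsClosed (B : Set A) := StarSubalgebra.isClosed_topologicalClosure _
  have : CompleteSpace B := hclosed.completeSpace_coe
  let _ : NormedCommRing B := { SubringClass.toNormedRing B with mul_comm := hcomm }
  let _ : CommCStarAlgebra B := {}
  have hSB : ∀ a ∈ S, a ∈ B := fun a ha =>
    StarSubalgebra.le_topologicalClosure _ (StarAlgebra.subset_adjoin ℂ S ha)
  let π₀' : C(X, ℂ) →⋆ₐ[ℂ] B := π₀.codRestrict B fun f => hSB _ (Or.inl ⟨f, rfl⟩)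
  let π' : ι → C(Y, ℂ) →⋆ₐ[ℂ] B := fun i =>
    (π i).codRestrict B fun f => hSB _ (Or.inr (Set.mem_iUnion.mpr ⟨i, f, rfl⟩))
  let R : C(WeakDual.characterSpace ℂ B, X × (ι → Y)) :=
    ⟨fun χ => ((homeoEval X ℂ).symm (compContinuousMap π₀' χ),
      fun i => (homeoEval Y ℂ).symm (compContinuousMap (π' i) χ)),
      ((homeoEval X ℂ).symm.continuous.comp (compContinuousMap π₀').continuous).prodMk
      (continuous_pi fun i => (homeoEval Y ℂ).symm.continuous.comp
        (compContinuousMap (π' i)).continuous)⟩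
  have hR₀ : ∀ (f : C(X, ℂ)) χ, f (R χ).1 = χ (π₀' f) := fun f χ =>
    DFunLike.congr_fun (congrArg Subtype.val
      ((homeoEval X ℂ).apply_symm_apply (compContinuousMap π₀' χ))) f
  have hR : ∀ i (f : C(Y, ℂ)) χ, f ((R χ).2 i) = χ (π' i f) := fun i f χ =>
    DFunLike.congr_fun (congrArg Subtype.val
      ((homeoEval Y ℂ).apply_symm_apply (compContinuousMap (π' i) χ))) f
  have key : ∀ (F : C(X × (ι → Y), ℂ)) (b : B), (∀ χ, F (R χ) = χ b) →
      (gelfandStarTransform B).symm (R.compStarAlgHom' ℂ ℂ F) = b := by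
    intro F b h
    rw [← (gelfandStarTransform B).symm_apply_apply b]
    congr 1
    ext χ
    exact h χ
  refine ⟨(B.subtype.comp ((gelfandStarTransform B).symm : _ →⋆ₐ[ℂ] _)).comp
    (R.compStarAlgHom' ℂ ℂ), fun f => ?_, fun i f => ?_⟩
  · exact congrArg Subtype.val (key (sysFun f) (π₀' f) (hR₀ f))
  · exact congrArg Subtype.val (key (coordFun i f) (π' i f) (hR i f))

/-- Stone-Weierstrass: product functions `x ↦ f(x) ∏_{i ∈ s} fᵢ(xᵢ)` span a dense subspace. -/
theorem dense_span_product :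
    Dense (Submodule.span ℂ {F : C(X × (ι → Y), ℂ) | ∃ (f : C(X, ℂ)) (s : Finset ι)
      (g : ι → C(Y, ℂ)), F = sysFun f * ∏ i ∈ s, coordFun i (g i)} :
        Set C(X × (ι → Y), ℂ)) := by
  classical
  set N := {F : C(X × (ι → Y), ℂ) | ∃ (f : C(X, ℂ)) (s : Finset ι)
      (g : ι → C(Y, ℂ)), F = sysFun f * ∏ i ∈ s, coordFun i (g i)} with hN
  let M : Submonoid C(X × (ι → Y), ℂ) :=
    { carrier := N
      one_mem' := ⟨1, ∅, 1, by ext; simp⟩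
      mul_mem' := by
        rintro _ _ ⟨f, s, g, rfl⟩ ⟨f', s', g', rfl⟩
        refine ⟨f * f', s ∪ s', fun i => (if i ∈ s then g i else 1) * (if i ∈ s' then g' i else 1),
          ?_⟩
        ext x
        simp only [ContinuousMap.mul_apply, ContinuousMap.prod_apply, coordFun_apply,
          sysFun_apply, Finset.prod_mul_distrib]
        have h1 : ∏ i ∈ s ∪ s', (if i ∈ s then g i else 1) (x.2 i) = ∏ i ∈ s, g i (x.2 i) := by
          rw [← Finset.prod_subset Finset.subset_union_left]
          · exact Finset.prod_congr rfl fun i hi => by rw [if_pos hi]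
          · intro i _ hi; rw [if_neg hi]; rfl
        have h2 : ∏ i ∈ s ∪ s', (if i ∈ s' then g' i else 1) (x.2 i) =
            ∏ i ∈ s', g' i (x.2 i) := by
          rw [← Finset.prod_subset Finset.subset_union_right]
          · exact Finset.prod_congr rfl fun i hi => by rw [if_pos hi]
          · intro i _ hi; rw [if_neg hi]; rfl
        rw [h1, h2]
        ring }
  have hstarN : ∀ F ∈ N, star F ∈ N := by
    rintro _ ⟨f, s, g, rfl⟩
    refine ⟨star f, s, fun i => star (g i), ?_⟩
    ext x
    simp [ContinuousMap.prod_apply]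
  have hspan : (Algebra.adjoin ℂ N).toSubmodule = Submodule.span ℂ N := by
    rw [Algebra.adjoin_eq_span]
    congr 1
    exact congrArg (fun K : Submonoid C(X × (ι → Y), ℂ) => (K : Set C(X × (ι → Y), ℂ)))
      (Submonoid.closure_eq M)
  have hstar : ∀ F ∈ Submodule.span ℂ N, star F ∈ Submodule.span ℂ N := by
    intro F hF
    induction hF using Submodule.span_induction with
    | mem F hF => exact Submodule.subset_span (hstarN F hF)
    | zero => simp
    | add F G _ _ hF hG => rw [star_add]; exact add_mem hF hG
    | smul c F _ hF => rw [star_smul]; exact Submodule.smul_mem _ _ hF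
  have hmem : ∀ F, F ∈ Algebra.adjoin ℂ N ↔ F ∈ Submodule.span ℂ N := fun F => by
    rw [← hspan]; rfl
  let A : StarSubalgebra ℂ C(X × (ι → Y), ℂ) :=
    { Algebra.adjoin ℂ N with
      star_mem' := fun {F} hF => (hmem _).mpr (hstar F ((hmem F).mp hF)) }
  have hNA : ∀ F ∈ N, F ∈ A := fun F hF => Algebra.subset_adjoin hF
  have hA : A.SeparatesPoints := by
    intro x y hxy
    by_cases h : x.1 = y.1
    · have h2 : ∃ i, x.2 i ≠ y.2 i := by
        by_contra! h2
        exact hxy (Prod.ext h (funext h2))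
      obtain ⟨i, hi⟩ := h2
      obtain ⟨f, hf, hf', -⟩ := exists_continuous_zero_one_of_isClosed
        (isClosed_singleton (x := x.2 i)) (isClosed_singleton (x := y.2 i))
        (Set.disjoint_singleton.mpr hi)
      let g : C(Y, ℂ) := ⟨fun z => (f z : ℂ), by fun_prop⟩
      refine ⟨_, ⟨coordFun i g, hNA _ ⟨1, {i}, fun _ => g, ?_⟩, rfl⟩, ?_⟩
      · ext; simp
      · simp [g, hf rfl, hf' rfl]
    · obtain ⟨f, hf, hf', -⟩ := exists_continuous_zero_one_of_isClosed
        (isClosed_singleton (x := x.1)) (isClosed_singleton (x := y.1))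
        (Set.disjoint_singleton.mpr h)
      let g : C(X, ℂ) := ⟨fun z => (f z : ℂ), by fun_prop⟩
      refine ⟨_, ⟨sysFun g, hNA _ ⟨g, ∅, 1, ?_⟩, rfl⟩, ?_⟩
      · ext; simp
      · simp [g, hf rfl, hf' rfl]
  have h := ContinuousMap.starSubalgebra_topologicalClosure_eq_top_of_separatesPoints A hA
  have hAN : (A : Set C(X × (ι → Y), ℂ)) = Submodule.span ℂ N := Set.ext hmem
  rw [← hAN, dense_iff_closure_eq, ← StarSubalgebra.topologicalClosure_coe, h]
  rfl

lemma eq_of_eq_on_products {V : Type*} [NormedAddCommGroup V] [NormedSpace ℂ V]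
    {S T : C(X × (ι → Y), ℂ) →L[ℂ] V}
    (h : ∀ f (s : Finset ι) (g : ι → C(Y, ℂ)),
      S (sysFun f * ∏ i ∈ s, coordFun i (g i)) = T (sysFun f * ∏ i ∈ s, coordFun i (g i))) :
    S = T := by
  refine ContinuousLinearMap.ext_on dense_span_product ?_
  rintro _ ⟨f, s, g, rfl⟩
  exact h f s g

lemma starAlgHom_ext_of_coord {A : Type*} [CStarAlgebra A] {m m' : C(X × (ι → Y), ℂ) →⋆ₐ[ℂ] A}
    (h₀ : ∀ f, m (sysFun f) = m' (sysFun f))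
    (h : ∀ i f, m (coordFun i f) = m' (coordFun i f)) : m = m' := by
  have : (⟨m.toAlgHom.toLinearMap, map_continuous m⟩ : C(X × (ι → Y), ℂ) →L[ℂ] A) =
      ⟨m'.toAlgHom.toLinearMap, map_continuous m'⟩ := by
    refine eq_of_eq_on_products fun f s g => ?_
    change m _ = m' _
    rw [map_mul, map_mul, h₀]
    congr 1
    classical
    induction s using Finset.induction_on with
    | empty => simp
    | insert i s hi ih => rw [Finset.prod_insert hi, map_mul, map_mul, h, ih]
  ext F
  exact DFunLike.congr_fun this F

end JointHom

/-! ### The stochastic map given by an isometry `H → H ⊗ Z` -/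

section StochasticMap

variable {H Z κ : Type*} [NormedAddCommGroup H] [InnerProductSpace ℂ H] [CompleteSpace H]
  [NormedAddCommGroup Z] [InnerProductSpace ℂ Z]

/-- The map `a ↦ W* (a ⊗ 1) W` on `𝓑(H)`, for `W : H → H ⊗ Z`. -/
def stinespringMap (W : H →L[ℂ] HilbertTensor H Z) : Op H →ₗ[ℂ] Op H where
  toFun a := W.adjoint ∘L opTensor a 1 ∘L W
  map_add' a b := by
    rw [opTensor_add_left, ContinuousLinearMap.add_comp, ContinuousLinearMap.comp_add]
  map_smul' c a := by
    rw [opTensor_smul_left, ContinuousLinearMap.smul_comp, ContinuousLinearMap.comp_smul]; rfl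

lemma inner_stinespringMap (W : H →L[ℂ] HilbertTensor H Z) (a : Op H) (h h' : H) :
    ⟪h, stinespringMap W a h'⟫_ℂ = ⟪W h, opTensor a 1 (W h')⟫_ℂ := by
  change ⟪h, W.adjoint (opTensor a 1 (W h'))⟫_ℂ = _
  rw [ContinuousLinearMap.adjoint_inner_right]

/-- The Kraus form of the map `a ↦ W* (a ⊗ 1) W`. -/
lemma stinespringMap_eq_sum [CompleteSpace Z] [Fintype κ] (f : OrthonormalBasis κ ℂ Z)
    (W : H →L[ℂ] HilbertTensor H Z) (a : Op H) :
    stinespringMap W a = ∑ g, star ((tensorRight (H := H) (f g)).adjoint ∘L W) * a *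
      ((tensorRight (H := H) (f g)).adjoint ∘L W) := by
  have h1 : opTensor a (1 : Op Z) =
      ∑ g, tensorRight (f g) ∘L a ∘L (tensorRight (H := H) (f g)).adjoint := by
    refine ext_vecTensor fun x y => ?_
    rw [opTensor_vecTensor, _root_.sum_apply]
    simp only [ContinuousLinearMap.comp_apply, adjoint_tensorRight_vecTensor, map_smul,
      tensorRight_apply, ← vecTensor_smul_right]
    change vecTensor (a x) y = _
    conv_lhs => rw [← f.sum_repr' y]
    exact map_sum (tensorLeft (a x)) _ _
  ext h
  change W.adjoint (opTensor a 1 (W h)) = _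
  rw [h1, _root_.sum_apply, map_sum, _root_.sum_apply]
  refine Finset.sum_congr rfl fun g _ => ?_
  rw [ContinuousLinearMap.star_eq_adjoint, ContinuousLinearMap.adjoint_comp,
    ContinuousLinearMap.adjoint_adjoint]
  rfl

/-- Finite sums of maps `a ↦ k* a k` are completely positive. -/
lemma nonneg_map_of_kraus {A : Type*} [CStarAlgebra A] [PartialOrder A] [StarOrderedRing A]
    [Fintype κ] (k : κ → A) (T : A →ₗ[ℂ] A) (hT : ∀ a, T a = ∑ g, star (k g) * a * k g)
    (n : ℕ) (M : CStarMatrix (Fin n) (Fin n) A) (hM : 0 ≤ M) : 0 ≤ M.map T := by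
  have h : M.map T = ∑ g, star (CStarMatrix.ofMatrix (Matrix.diagonal fun _ => k g)) * M *
      CStarMatrix.ofMatrix (Matrix.diagonal fun _ => k g) := by
    ext i j
    refine Eq.trans ?_ (Matrix.sum_apply i j Finset.univ fun g =>
      star (CStarMatrix.ofMatrix (Matrix.diagonal fun _ => k g)) * M *
        CStarMatrix.ofMatrix (Matrix.diagonal fun _ => k g)).symm
    rw [CStarMatrix.map_apply, hT]
    refine Finset.sum_congr rfl fun g _ => ?_
    change _ = (star (CStarMatrix.ofMatrix (Matrix.diagonal fun _ => k g)) * M *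
      CStarMatrix.ofMatrix (Matrix.diagonal fun _ => k g) : CStarMatrix (Fin n) (Fin n) A) i j
    simp [CStarMatrix.mul_apply, CStarMatrix.star_apply, CStarMatrix.ofMatrix_apply,
      Matrix.diagonal_apply, apply_ite star, ite_mul, mul_ite]
  rw [h]
  exact Finset.sum_nonneg fun g _ => star_left_conjugate_nonneg hM _

lemma isStochasticMap_stinespringMap [CompleteSpace Z] [Fintype κ] (f : OrthonormalBasis κ ℂ Z)
    (W : H →L[ℂ] HilbertTensor H Z) (hW : W.adjoint ∘L W = 1) :
    IsStochasticMap (stinespringMap W) := by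
  refine ⟨⟨{ stinespringMap W with
    map_cstarMatrix_nonneg' := fun n M hM =>
      nonneg_map_of_kraus _ (stinespringMap W) (stinespringMap_eq_sum f W) n M hM }, rfl⟩, ?_⟩
  change W.adjoint ∘L opTensor 1 1 ∘L W = 1
  rw [opTensor_one]
  exact hW

end StochasticMap

/-! ### Dilation of the semigroup -/

section SemigroupDilation

variable {H Z : Type*} [NormedAddCommGroup H] [InnerProductSpace ℂ H]
  [NormedAddCommGroup Z] [InnerProductSpace ℂ Z]

/-- The operator `h ↦ V (h ⊗ φ)`, an isometry for unitary `V`. -/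
def inputIsometry (V : Op (HilbertTensor H Z)) (φ : Metric.sphere (0 : Z) 1) :
    H →L[ℂ] HilbertTensor H Z := V ∘L tensorRight (φ : Z)

lemma inner_conjBy {X : Type*} [NormedAddCommGroup X] [InnerProductSpace ℂ X]
    [CompleteSpace X] (V : unitary (Op X)) (A : Op X) (x y : X) :
    ⟪x, conjBy V A y⟫_ℂ = ⟪(V : Op X) x, A ((V : Op X) y)⟫_ℂ := by
  change ⟪x, star (V : Op X) (A ((V : Op X) y))⟫_ℂ = _
  rw [ContinuousLinearMap.star_eq_adjoint, ContinuousLinearMap.adjoint_inner_right]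

lemma inner_sphere_self (φ : Metric.sphere (0 : Z) 1) : ⟪(φ : Z), (φ : Z)⟫_ℂ = 1 := by
  simp [inner_self_eq_norm_sq_to_K]

lemma norm_constVec (φ : Metric.sphere (0 : Z) 1) : ‖constVec φ‖ = 1 := by
  have h : ⟪constVec φ, constVec φ⟫_ℂ = 1 := by
    rw [constVec, inner_tprod]
    simp
  rw [@norm_eq_sqrt_re_inner ℂ, h]
  simp

lemma adjoint_comp_inputIsometry [CompleteSpace H] (V : unitary (Op (HilbertTensor H Z)))
    (φ : Metric.sphere (0 : Z) 1) :
    (inputIsometry (V : Op (HilbertTensor H Z)) φ).adjoint ∘L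
      inputIsometry (V : Op (HilbertTensor H Z)) φ = 1 := by
  ext1 h
  refine ext_inner_left ℂ fun h' => ?_
  rw [ContinuousLinearMap.comp_apply, ContinuousLinearMap.adjoint_inner_right, inputIsometry,
    ContinuousLinearMap.comp_apply, ContinuousLinearMap.comp_apply, Unitary.inner_map_map,
    tensorRight_apply, tensorRight_apply, inner_vecTensor, inner_sphere_self, mul_one]
  rfl

/-- The closed subspace of `H ⊗ ⨂_ℤ Z` in which the places `n ≥ 1` are in the state `φ`. -/
def futureInput (H : Type*) [NormedAddCommGroup H] [InnerProductSpace ℂ H]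
    (φ : Metric.sphere (0 : Z) 1) : Submodule ℂ (HilbertTensor H (StabTensor φ)) :=
  (Submodule.span ℂ {x | ∃ (h : H) (u : StabFamily fun _ : ℤ => φ),
    (∀ n, 1 ≤ n → u.vec n = φ) ∧ x = vecTensor h (tprod _ u)}).topologicalClosure

lemma inner_eq_on_closure_span {X : Type*} [NormedAddCommGroup X] [InnerProductSpace ℂ X]
    (S : Set X) (A B : Op X) (h : ∀ x ∈ S, ∀ y ∈ S, ⟪x, A y⟫_ℂ = ⟪x, B y⟫_ℂ) {x y : X}
    (hx : x ∈ (Submodule.span ℂ S).topologicalClosure)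
    (hy : y ∈ (Submodule.span ℂ S).topologicalClosure) : ⟪x, A y⟫_ℂ = ⟪x, B y⟫_ℂ := by
  have key : (Submodule.span ℂ S).topologicalClosure ≤
      (Submodule.span ℂ S).topologicalClosureᗮ.comap (A - B).toLinearMap := by
    refine Submodule.topologicalClosure_minimal _ (Submodule.span_le.mpr fun y hy => ?_)
      ((Submodule.isClosed_orthogonal _).preimage (A - B).continuous)
    rw [Submodule.orthogonal_closure]
    refine (Submodule.mem_orthogonal _ _).mpr fun x hx => ?_
    change ⟪x, (A - B) y⟫_ℂ = 0
    induction hx using Submodule.span_induction with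
    | mem x hx => simp [h x hx y hy]
    | zero => simp
    | add a b _ _ ha hb => rw [inner_add_left, ha, hb, add_zero]
    | smul c a _ ha => rw [inner_smul_left, ha, mul_zero]
  have h0 := (Submodule.mem_orthogonal _ _).mp (key hy) x hx
  change ⟪x, (A - B) y⟫_ℂ = 0 at h0
  rwa [_root_.sub_apply, inner_sub_right, sub_eq_zero] at h0

variable {φ : Metric.sphere (0 : Z) 1} {V : unitary (Op (HilbertTensor H Z))}
  {Θ V₁ : unitary (Op (HilbertTensor H (StabTensor φ)))}

/-- The new data produced by one step appear at the place `0`. -/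
lemma evolution_apply (hΘ : IsShift φ (Θ : Op (HilbertTensor H (StabTensor φ))))
    (hV : IsAmpliation (fun _ : ℤ => φ) 1 (V : Op (HilbertTensor H Z))
      (V₁ : Op (HilbertTensor H (StabTensor φ)))) (h : H) (u : StabFamily fun _ : ℤ => φ) :
    ((Θ * V₁ : unitary (Op (HilbertTensor H (StabTensor φ)))) :
        Op (HilbertTensor H (StabTensor φ))) (vecTensor h (tprod _ u)) =
      siteEmb _ H u.shift 0 ((V : Op (HilbertTensor H Z)) (vecTensor h (u.vec 1))) := by
  rw [Submonoid.coe_mul, mul_apply_eq_comp, (isAmpliation_iff_vecTensor _).mp hV]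
  exact hΘ.map_siteEmb u 0 _

lemma evolution_mem_futureInput (hΘ : IsShift φ (Θ : Op (HilbertTensor H (StabTensor φ))))
    (hV : IsAmpliation (fun _ : ℤ => φ) 1 (V : Op (HilbertTensor H Z))
      (V₁ : Op (HilbertTensor H (StabTensor φ)))) {x : HilbertTensor H (StabTensor φ)}
    (hx : x ∈ futureInput H φ) :
    ((Θ * V₁ : unitary (Op (HilbertTensor H (StabTensor φ)))) :
        Op (HilbertTensor H (StabTensor φ))) x ∈ futureInput H φ := by
  have hcl : IsClosed (futureInput H φ : Set (HilbertTensor H (StabTensor φ))) :=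
    Submodule.isClosed_topologicalClosure _
  set U := ((Θ * V₁ : unitary (Op (HilbertTensor H (StabTensor φ)))) :
        Op (HilbertTensor H (StabTensor φ))) with hU
  have key : futureInput H φ ≤ (futureInput H φ).comap U.toLinearMap := by
    refine Submodule.topologicalClosure_minimal _ (Submodule.span_le.mpr ?_)
      (hcl.preimage U.continuous)
    rintro _ ⟨h, u, hu, rfl⟩
    change U _ ∈ futureInput H φ
    rw [hU, evolution_apply hΘ hV]
    generalize (V : Op (HilbertTensor H Z)) (vecTensor h (u.vec 1)) = z
    have hz : z ∈ (Submodule.span ℂ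
        (Set.range fun p : H × Z => vecTensor p.1 p.2)).topologicalClosure := by
      rw [Submodule.dense_iff_topologicalClosure_eq_top.mp dense_span_vecTensor_univ]
      trivial
    have : (Submodule.span ℂ
        (Set.range fun p : H × Z => vecTensor p.1 p.2)).topologicalClosure ≤
        (futureInput H φ).comap (siteEmb (fun _ : ℤ => φ) H u.shift 0).toLinearMap := by
      refine Submodule.topologicalClosure_minimal _ (Submodule.span_le.mpr ?_)
        (hcl.preimage (siteEmb (fun _ : ℤ => φ) H u.shift 0).continuous)
      rintro _ ⟨⟨h', w⟩, rfl⟩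
      change siteEmb (fun _ : ℤ => φ) H u.shift 0 (vecTensor h' w) ∈ futureInput H φ
      rw [siteEmb_vecTensor]
      refine Submodule.le_topologicalClosure _ (Submodule.subset_span ⟨h', _, fun n hn => ?_, rfl⟩)
      rw [StabFamily.update_vec_of_ne _ (by omega), StabFamily.shift_vec]
      exact hu _ (by omega)
    exact this hz
  exact key hx

variable [CompleteSpace H] [CompleteSpace Z]

/-- One step of the evolution, in the Heisenberg picture and compressed to fresh input, is `T`. -/
lemma inner_evolution (hΘ : IsShift φ (Θ : Op (HilbertTensor H (StabTensor φ))))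
    (hV : IsAmpliation (fun _ : ℤ => φ) 1 (V : Op (HilbertTensor H Z))
      (V₁ : Op (HilbertTensor H (StabTensor φ)))) (a : Op H)
    {x y : HilbertTensor H (StabTensor φ)} (hx : x ∈ futureInput H φ)
    (hy : y ∈ futureInput H φ) :
    ⟪x, conjBy (Θ * V₁) (opTensor a 1) y⟫_ℂ =
      ⟪x, opTensor (stinespringMap (inputIsometry V φ) a) 1 y⟫_ℂ := by
  refine inner_eq_on_closure_span _ _ _ ?_ hx hy
  rintro _ ⟨h, u, hu, rfl⟩ _ ⟨h', u', hu', rfl⟩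
  have h1 : ∀ (h : H) (u : StabFamily fun _ : ℤ => φ), (∀ n, 1 ≤ n → u.vec n = φ) →
      vecTensor h (tprod _ u) = siteEmb (fun _ : ℤ => φ) H u (0 + 1) (vecTensor h (φ : Z)) := by
    intro h u hu
    rw [siteEmb_vecTensor, zero_add]
    conv_rhs => rw [← hu 1 le_rfl]
    rw [StabFamily.update_eq_self]
  rw [inner_conjBy, evolution_apply hΘ hV, evolution_apply hΘ hV, hu 1 le_rfl, hu' 1 le_rfl,
    ← amp_opTensor_one (fun _ : ℤ => φ) 0, amp_siteEmb, inner_siteEmb, opTensor_vecTensor,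
    one_apply_eq_self, h1 h u hu, h1 _ _ hu', ← Unitary.inner_map_map Θ, hΘ.map_siteEmb,
    hΘ.map_siteEmb, inner_siteEmb, inner_vecTensor, inner_sphere_self, mul_one,
    inner_stinespringMap]
  rfl

/-- As the evolution preserves `futureInput`, the one-step identity can be iterated. -/
lemma inner_evolution_pow (hΘ : IsShift φ (Θ : Op (HilbertTensor H (StabTensor φ))))
    (hV : IsAmpliation (fun _ : ℤ => φ) 1 (V : Op (HilbertTensor H Z))
      (V₁ : Op (HilbertTensor H (StabTensor φ)))) (t : ℕ) (a : Op H)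
    {x y : HilbertTensor H (StabTensor φ)} (hx : x ∈ futureInput H φ)
    (hy : y ∈ futureInput H φ) :
    ⟪x, conjBy ((Θ * V₁) ^ t) (opTensor a 1) y⟫_ℂ =
      ⟪x, opTensor ((stinespringMap (inputIsometry V φ) ^ t) a) 1 y⟫_ℂ := by
  induction t generalizing x y with
  | zero => simp [conjBy]
  | succ t ih =>
    have h1 : conjBy ((Θ * V₁) ^ (t + 1)) (opTensor a (1 : Op (StabTensor φ))) =
        conjBy (Θ * V₁) (conjBy ((Θ * V₁) ^ t) (opTensor a 1)) := by
      simp only [conjBy, pow_succ (Θ * V₁) t, Submonoid.coe_mul, star_mul, mul_assoc]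
    rw [h1, inner_conjBy, ih (evolution_mem_futureInput hΘ hV hx)
      (evolution_mem_futureInput hΘ hV hy), ← inner_conjBy, inner_evolution hΘ hV _ hx hy,
      pow_succ']
    rfl

theorem isSemigroupDilation_evolution {κ : Type*} [Fintype κ] (e : OrthonormalBasis κ ℂ H)
    (hΘ : IsShift φ (Θ : Op (HilbertTensor H (StabTensor φ))))
    (hV : IsAmpliation (fun _ : ℤ => φ) 1 (V : Op (HilbertTensor H Z))
      (V₁ : Op (HilbertTensor H (StabTensor φ)))) :
    IsSemigroupDilation (stinespringMap (inputIsometry V φ)) (Θ * V₁)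
      (pureState (constVec φ)) := by
  refine fun t => ⟨isState_pureState (norm_constVec φ), fun a => isCondExp_pureState e ?_⟩
  intro h h'
  have hmem : ∀ h : H, vecTensor h (constVec φ) ∈ futureInput H φ := fun h =>
    Submodule.le_topologicalClosure _ (Submodule.subset_span ⟨h, _, fun n _ => rfl, rfl⟩)
  rw [inner_evolution_pow hΘ hV t a (hmem h) (hmem h'), opTensor_vecTensor, inner_vecTensor]
  change _ = _ * ⟪constVec φ, constVec φ⟫_ℂ
  rw [inner_self_eq_norm_sq_to_K, norm_constVec]
  simp

end SemigroupDilation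

/-! ### Diagonal operators -/

section Diagonal

variable {X : Type*} [Fintype X] [DecidableEq X]

/-- The diagonal operator with entries `f` in the canonical basis. -/
def diagOp : (X → ℂ) →⋆ₐ[ℂ] Op (EuclideanSpace ℂ X) :=
  ((Matrix.toEuclideanCLM (n := X) (𝕜 := ℂ) : _ →⋆ₐ[ℂ] _)).comp
    { Matrix.diagonalAlgHom ℂ with
      map_star' := fun f => (Matrix.diagonal_conjTranspose f).symm }

lemma diagOp_apply (f : X → ℂ) (x : EuclideanSpace ℂ X) (i : X) :
    diagOp f x i = f i * x i := by
  change (Matrix.diagonal f).mulVec x i = _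
  rw [Matrix.mulVec_diagonal]

@[simp] lemma diagOp_single (f : X → ℂ) (i : X) :
    diagOp f (EuclideanSpace.single i (1 : ℂ)) = f i • EuclideanSpace.single i (1 : ℂ) := by
  ext j
  rw [diagOp_apply]
  by_cases h : j = i
  · subst h; simp
  · simp [h]

lemma diagOp_injective : Function.Injective (diagOp (X := X)) := by
  intro f g h
  funext i
  have := congrArg (fun A : Op (EuclideanSpace ℂ X) => A (EuclideanSpace.single i 1) i) h
  simpa [diagOp_apply] using this

lemma inner_single_self (i : X) :
    ⟪EuclideanSpace.single i (1 : ℂ), EuclideanSpace.single i (1 : ℂ)⟫_ℂ = 1 := by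
  simp

lemma inner_single_of_ne {i j : X} (h : i ≠ j) :
    ⟪EuclideanSpace.single i (1 : ℂ), EuclideanSpace.single j (1 : ℂ)⟫_ℂ = 0 := by
  rw [EuclideanSpace.inner_single_left]
  simp [h]

end Diagonal

/-! ### The permutation unitary -/

section Pair

variable {E G : Type*} [Fintype E] [DecidableEq E] [Fintype G] [DecidableEq G]

lemma dense_span_single (X : Type*) [Fintype X] [DecidableEq X] :
    Dense (Submodule.span ℂ (Set.range fun i : X => EuclideanSpace.single i (1 : ℂ)) :
      Set (EuclideanSpace ℂ X)) := by
  have h := (EuclideanSpace.basisFun X ℂ).toBasis.span_eq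
  have h2 : (Set.range fun i : X => EuclideanSpace.single i (1 : ℂ)) =
      Set.range (EuclideanSpace.basisFun X ℂ).toBasis := by
    congr 1; funext i; simp
  rw [h2, h]
  exact dense_univ

lemma ext_single {F : Type*} [NormedAddCommGroup F] [NormedSpace ℂ F]
    {A B : HilbertTensor (EuclideanSpace ℂ E) (EuclideanSpace ℂ G) →L[ℂ] F}
    (h : ∀ i g, A (vecTensor (EuclideanSpace.single i 1) (EuclideanSpace.single g 1)) =
      B (vecTensor (EuclideanSpace.single i 1) (EuclideanSpace.single g 1))) : A = B := by
  refine ContinuousLinearMap.ext_on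
    (dense_span_vecTensor (dense_span_single E) (dense_span_single G)) ?_
  rintro _ ⟨p, rfl⟩
  exact h _ _

/-- The diagonal operator on `ℂ^E ⊗ ℂ^G` with entries `F`. -/
def pairOp (F : E × G → ℂ) : Op (HilbertTensor (EuclideanSpace ℂ E) (EuclideanSpace ℂ G)) :=
  ∑ p : E × G, F p • opTensor (diagOp (Pi.single p.1 1)) (diagOp (Pi.single p.2 1))

lemma pairOp_single (F : E × G → ℂ) (i : E) (g : G) :
    pairOp F (vecTensor (EuclideanSpace.single i 1) (EuclideanSpace.single g 1)) =
      F (i, g) • vecTensor (EuclideanSpace.single i 1) (EuclideanSpace.single g 1) := by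
  rw [pairOp, _root_.sum_apply, Finset.sum_eq_single (i, g)]
  · simp
  · rintro ⟨j, k⟩ _ h
    rw [_root_.smul_apply, opTensor_vecTensor, diagOp_single, diagOp_single,
      vecTensor_smul_left, vecTensor_smul_right]
    by_cases hj : i = j
    · have hk : g ≠ k := fun hk => h (by rw [hj, hk])
      simp [hk]
    · simp [hj]
  · simp

lemma pairOp_fst (f : E → ℂ) :
    pairOp (G := G) (fun p => f p.1) = opTensor (diagOp f) 1 :=
  ext_single fun i g => by simp [pairOp_single, vecTensor_smul_left]

lemma pairOp_snd (f : G → ℂ) :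
    pairOp (E := E) (fun p => f p.2) = opTensor 1 (diagOp f) :=
  ext_single fun i g => by simp [pairOp_single, vecTensor_smul_right]

lemma completionEquiv_coe {X Y : Type*} [NormedAddCommGroup X] [InnerProductSpace ℂ X]
    [NormedAddCommGroup Y] [InnerProductSpace ℂ Y] (e : X ≃ₗᵢ[ℂ] Y) (x : X) :
    completionEquiv e (x : UniformSpace.Completion X) = (e x : UniformSpace.Completion Y) := by
  change (e : X →L[ℂ] Y).completion (x : UniformSpace.Completion X) = _
  simp

lemma permUnitary_single (φ : Equiv.Perm (E × G)) (i : E) (g : G) :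
    (permUnitary φ : Op (HilbertTensor (EuclideanSpace ℂ E) (EuclideanSpace ℂ G)))
        (vecTensor (EuclideanSpace.single i 1) (EuclideanSpace.single g 1)) =
      vecTensor (EuclideanSpace.single (φ (i, g)).1 1)
        (EuclideanSpace.single (φ (i, g)).2 1) := by
  set b := (EuclideanSpace.basisFun E ℂ).tensorProduct (EuclideanSpace.basisFun G ℂ) with hb
  have hbv : ∀ p : E × G, ((b p : _) : UniformSpace.Completion _) =
      vecTensor (EuclideanSpace.single p.1 (1 : ℂ)) (EuclideanSpace.single p.2 (1 : ℂ)) := by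
    intro p
    rw [hb, OrthonormalBasis.tensorProduct_apply']
    simp [vecTensor]
  have h1 : (b.equiv b φ) (b (i, g)) = b (φ (i, g)) := by simp
  rw [← hbv (i, g), ← hbv (φ (i, g)), ← h1]
  exact completionEquiv_coe (b.equiv b φ) (b (i, g))

/-- The permutation unitary implements the permutation on the diagonal operators. -/
lemma conjBy_permUnitary_pairOp (φ : Equiv.Perm (E × G)) (F : E × G → ℂ) :
    conjBy (permUnitary φ) (pairOp F) = pairOp (fun p => F (φ p)) := by
  have h : pairOp F * (permUnitary φ : Op _) = (permUnitary φ : Op _) * pairOp fun p => F (φ p) :=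
    ext_single fun i g => by
      rw [mul_apply_eq_comp, mul_apply_eq_comp, permUnitary_single, pairOp_single, pairOp_single,
        map_smul, permUnitary_single]
  rw [conjBy, mul_assoc, h, ← mul_assoc, Unitary.coe_star_mul_self, one_mul]

end Pair

/-! ### Representation of the continuous functions -/

section Observables

variable {E G : Type*} [Fintype E] [DecidableEq E] [TopologicalSpace E]
  [Fintype G] [DecidableEq G] [TopologicalSpace G]

/-- The diagonal operators, on continuous functions. -/
def contDiagOp (X : Type*) [Fintype X] [DecidableEq X] [TopologicalSpace X] :
    C(X, ℂ) →⋆ₐ[ℂ] Op (EuclideanSpace ℂ X) :=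
  diagOp.comp
    { toFun := fun f => ⇑f
      map_one' := rfl
      map_mul' := fun _ _ => rfl
      map_zero' := rfl
      map_add' := fun _ _ => rfl
      commutes' := fun _ => rfl
      map_star' := fun _ => rfl }

variable {ψ : Metric.sphere (0 : EuclideanSpace ℂ G) 1}

/-- `m` represents the functions of the system by diagonal operators on `ℂ^E`, and the functions of
the `n`-th coordinate by diagonal operators at the place `n`. -/
def IsMultiplication
    (m : C(E × (ℤ → G), ℂ) →⋆ₐ[ℂ] Op (HilbertTensor (EuclideanSpace ℂ E) (StabTensor ψ))) :
    Prop :=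
  (∀ f : C(E, ℂ), m (sysFun f) = opTensor (diagOp f) 1) ∧
    ∀ n (f : C(G, ℂ)), m (coordFun n f) = amp (fun _ : ℤ => ψ) n (opTensor 1 (diagOp f))

variable [DiscreteTopology E] [DiscreteTopology G]

variable (E ψ) in
lemma exists_isMultiplication :
    ∃ m : C(E × (ℤ → G), ℂ) →⋆ₐ[ℂ] Op (HilbertTensor (EuclideanSpace ℂ E) (StabTensor ψ)),
      IsMultiplication m := by
  have h := exists_joint_starAlgHom (ι := ℤ)
    (((ampLeft (K := StabTensor ψ)).comp (contDiagOp E)))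
    (fun n => ((amp (fun _ : ℤ => ψ) n).comp
      (ampRight (H := EuclideanSpace ℂ E) (K := EuclideanSpace ℂ G))).comp (contDiagOp G))
    (fun i f g => by
      change Commute (opTensor (diagOp f) 1) (amp (fun _ : ℤ => ψ) i (opTensor 1 (diagOp g)))
      rw [← amp_opTensor_one (fun _ : ℤ => ψ) i]
      refine Commute.map (?_ : Commute (opTensor (diagOp f) 1) (opTensor 1 (diagOp g))) _
      rw [Commute, SemiconjBy, opTensor_mul, opTensor_mul]
      simp)
    (fun i j hij f g => commute_amp _ hij _ _)
  exact h

end Observables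

/-! ### Covariance of representations of `C(X)` -/

section Conjugation

lemma conjBy_mul {A : Type*} [Monoid A] [StarMul A] (U V : unitary A) (a : A) :
    conjBy (U * V) a = conjBy V (conjBy U a) := by
  simp only [conjBy, Submonoid.coe_mul, star_mul, mul_assoc]

/-- The automorphism `a ↦ U* a U` as a `*`-homomorphism. -/
def conjHom {A : Type*} [CStarAlgebra A] (U : unitary A) : A →⋆ₐ[ℂ] A where
  toFun := conjBy U
  map_one' := by simp [conjBy]
  map_mul' a b := by
    rw [conjBy, conjBy, conjBy, mul_assoc _ _ (star (U : A) * b * U), mul_assoc (star (U : A)) b,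
      ← mul_assoc (U : A), Unitary.mul_star_self_of_mem U.2, one_mul]
    simp only [mul_assoc]
  map_zero' := by simp [conjBy]
  map_add' a b := by simp [conjBy, mul_add, add_mul]
  commutes' c := by
    rw [conjBy, Algebra.algebraMap_eq_smul_one, mul_smul_comm, mul_one, smul_mul_assoc,
      Unitary.coe_star_mul_self]
  map_star' a := by simp [conjBy, mul_assoc]

variable {X Y A : Type*} [CStarAlgebra A] [TopologicalSpace X] [TopologicalSpace Y]

/-- It is enough to check covariance on functions of one coordinate. -/
lemma conjBy_map_of_coord {ι : Type*} [CompactSpace X] [T2Space X] [CompactSpace Y] [T2Space Y]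
    (m : C(X × (ι → Y), ℂ) →⋆ₐ[ℂ] A) (U : unitary A) (α : C(X × (ι → Y), X × (ι → Y)))
    (h₀ : ∀ f, conjBy U (m (sysFun f)) = m ((sysFun f).comp α))
    (h : ∀ i f, conjBy U (m (coordFun i f)) = m ((coordFun i f).comp α)) (F : C(X × (ι → Y), ℂ)) :
    conjBy U (m F) = m (F.comp α) := by
  have h : (conjHom U).comp m = m.comp (α.compStarAlgHom' ℂ ℂ) := starAlgHom_ext_of_coord h₀ h
  exact DFunLike.congr_fun h F

lemma conjBy_zpow_map (m : C(X, ℂ) →⋆ₐ[ℂ] A) (U : unitary A) (α : X ≃ₜ X)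
    (h1 : ∀ F, conjBy U (m F) = m (F.comp ⟨α, α.continuous⟩)) (t : ℤ) (F : C(X, ℂ)) :
    conjBy (U ^ t) (m F) = m (F.comp ⟨⇑(α ^ t), (α ^ t).continuous⟩) := by
  have hinv : ∀ F : C(X, ℂ), conjBy U⁻¹ (m F) = m (F.comp ⟨⇑α⁻¹, α⁻¹.continuous⟩) := by
    intro F
    have h2 := h1 (F.comp ⟨⇑α⁻¹, α⁻¹.continuous⟩)
    have h3 : (F.comp ⟨⇑α⁻¹, α⁻¹.continuous⟩).comp ⟨α, α.continuous⟩ = F := by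
      ext x
      exact congrArg F (α.symm_apply_apply x)
    rw [h3] at h2
    rw [← h2, ← conjBy_mul, mul_inv_cancel]
    simp [conjBy]
  induction t using Int.induction_on generalizing F with
  | zero =>
    have h3 : F.comp ⟨⇑(α ^ (0 : ℤ)), (α ^ (0 : ℤ)).continuous⟩ = F := by
      ext x
      rfl
    rw [h3]
    simp [conjBy]
  | succ n ih =>
    rw [zpow_add_one, conjBy_mul, ih, h1]
    congr 1
  | pred n ih =>
    rw [zpow_sub_one, conjBy_mul, ih, hinv]
    congr 1
    ext x
    exact congrArg (fun g : X ≃ₜ X => F (g x)) (zpow_sub_one α (-(n : ℤ))).symm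

end Conjugation

/-! ### Covariance under the global evolution -/

section Covariance

variable {E G : Type*} [Fintype E] [DecidableEq E] [TopologicalSpace E]
  [Fintype G] [DecidableEq G] [TopologicalSpace G]
  {ψ : Metric.sphere (0 : EuclideanSpace ℂ G) 1}

variable [DiscreteTopology E] [DiscreteTopology G]

/-- The function `x ↦ F (x₀, xₙ)` of the system and the `n`-th coordinate. -/
def pairFun (n : ℤ) (F : E × G → ℂ) : C(E × (ℤ → G), ℂ) :=
  ⟨fun x => F (x.1, x.2 n),
    continuous_of_discreteTopology.comp
      (continuous_fst.prodMk ((continuous_apply n).comp continuous_snd))⟩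

lemma pairFun_eq_sum (n : ℤ) (F : E × G → ℂ) :
    pairFun n F = ∑ p : E × G, F p •
      (sysFun ⟨Pi.single p.1 1, continuous_of_discreteTopology⟩ *
        coordFun n ⟨Pi.single p.2 1, continuous_of_discreteTopology⟩) := by
  ext x
  rw [ContinuousMap.sum_apply, Finset.sum_eq_single (x.1, x.2 n)]
  · simp [pairFun]
  · rintro ⟨j, k⟩ _ h
    by_cases hj : x.1 = j
    · have hk : x.2 n ≠ k := fun hk => h (by rw [hj, hk])
      simp [hk]
    · simp [hj]
  · simp

lemma map_sum_smul {A B κ : Type*} [CStarAlgebra A] [CStarAlgebra B] (f : A →⋆ₐ[ℂ] B)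
    (s : Finset κ) (c : κ → ℂ) (a : κ → A) :
    f (∑ p ∈ s, c p • a p) = ∑ p ∈ s, c p • f (a p) := by
  simp

variable {m : C(E × (ℤ → G), ℂ) →⋆ₐ[ℂ] Op (HilbertTensor (EuclideanSpace ℂ E) (StabTensor ψ))}

lemma IsMultiplication.map_pairFun (hm : IsMultiplication m) (n : ℤ) (F : E × G → ℂ) :
    m (pairFun n F) = amp (fun _ : ℤ => ψ) n (pairOp F) := by
  rw [pairFun_eq_sum, pairOp, map_sum_smul, map_sum_smul]
  refine Finset.sum_congr rfl fun p _ => ?_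
  rw [map_mul, hm.1, hm.2, ← amp_opTensor_one (fun _ : ℤ => ψ) n, ← map_mul,
    opTensor_mul, one_mul, mul_one]
  rfl

/-- The unitary `V` on `H ⊗ Z₁`, extended to `H ⊗ ⨂_ℤ Z`. -/
def ampUnitary {H Z : Type*} [NormedAddCommGroup H] [InnerProductSpace ℂ H] [CompleteSpace H]
    [NormedAddCommGroup Z] [InnerProductSpace ℂ Z] [CompleteSpace Z]
    (ψ : Metric.sphere (0 : Z) 1) (V : unitary (Op (HilbertTensor H Z))) :
    unitary (Op (HilbertTensor H (StabTensor ψ))) :=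
  ⟨amp (fun _ : ℤ => ψ) 1 (V : Op (HilbertTensor H Z)), Unitary.map_mem _ V.2⟩

lemma conjBy_shift_amp {H Z : Type*} [NormedAddCommGroup H] [InnerProductSpace ℂ H]
    [CompleteSpace H] [NormedAddCommGroup Z] [InnerProductSpace ℂ Z] [CompleteSpace Z]
    {ψ : Metric.sphere (0 : Z) 1} {Θ : unitary (Op (HilbertTensor H (StabTensor ψ)))}
    (hΘ : IsShift ψ (Θ : Op (HilbertTensor H (StabTensor ψ)))) (n : ℤ)
    (Y : Op (HilbertTensor H Z)) :
    conjBy Θ (amp (fun _ : ℤ => ψ) n Y) = amp (fun _ : ℤ => ψ) (n + 1) Y := by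
  rw [conjBy, mul_assoc, hΘ.mul_amp, ← mul_assoc, Unitary.coe_star_mul_self, one_mul]

lemma conjBy_ampUnitary_one {H Z : Type*} [NormedAddCommGroup H] [InnerProductSpace ℂ H]
    [CompleteSpace H] [NormedAddCommGroup Z] [InnerProductSpace ℂ Z] [CompleteSpace Z]
    (ψ : Metric.sphere (0 : Z) 1) (V : unitary (Op (HilbertTensor H Z)))
    (Y : Op (HilbertTensor H Z)) :
    conjBy (ampUnitary ψ V) (amp (fun _ : ℤ => ψ) 1 Y) =
      amp (fun _ : ℤ => ψ) 1 (conjBy V Y) := by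
  rw [conjBy, conjBy, map_mul, map_mul, map_star]
  rfl

lemma conjBy_ampUnitary_of_ne {H Z : Type*} [NormedAddCommGroup H] [InnerProductSpace ℂ H]
    [CompleteSpace H] [NormedAddCommGroup Z] [InnerProductSpace ℂ Z] [CompleteSpace Z]
    (ψ : Metric.sphere (0 : Z) 1) (V : unitary (Op (HilbertTensor H Z))) {n : ℤ} (hn : 1 ≠ n)
    (b : Op Z) :
    conjBy (ampUnitary ψ V) (amp (fun _ : ℤ => ψ) n (opTensor 1 b)) =
      amp (fun _ : ℤ => ψ) n (opTensor 1 b) := by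
  have h : amp (fun _ : ℤ => ψ) n (opTensor 1 b) *
        (ampUnitary ψ V : Op (HilbertTensor H (StabTensor ψ))) =
      (ampUnitary ψ V : Op (HilbertTensor H (StabTensor ψ))) *
        amp (fun _ : ℤ => ψ) n (opTensor 1 b) :=
    (commute_amp (fun _ : ℤ => ψ) hn (V : Op (HilbertTensor H Z)) b).symm.eq
  rw [conjBy, mul_assoc, h, ← mul_assoc, Unitary.coe_star_mul_self, one_mul]

variable {Θ : unitary (Op (HilbertTensor (EuclideanSpace ℂ E) (StabTensor ψ)))}

set_option maxHeartbeats 1000000 in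
/-- The dynamics is implemented by `U = Θ V₁` for one step. -/
lemma IsMultiplication.conjBy_evolution (hm : IsMultiplication m)
    (hΘ : IsShift ψ (Θ : Op (HilbertTensor (EuclideanSpace ℂ E) (StabTensor ψ))))
    (φ : Equiv.Perm (E × G)) (F : C(E × (ℤ → G), ℂ)) :
    conjBy (Θ * ampUnitary ψ (permUnitary φ)) (m F) =
      m (F.comp ⟨globalMap φ, (globalMap φ).continuous⟩) := by
  refine conjBy_map_of_coord m _ _ (fun f => ?_) (fun n f => ?_) F
  · have h1 : (sysFun f).comp ⟨globalMap φ, (globalMap φ).continuous⟩ =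
        pairFun 1 (fun p => f (φ p).1) := by
      ext x; rfl
    rw [h1, hm.map_pairFun, hm.1, ← amp_opTensor_one (fun _ : ℤ => ψ) 0, conjBy_mul,
      conjBy_shift_amp hΘ, ← pairOp_fst, zero_add, conjBy_ampUnitary_one,
      conjBy_permUnitary_pairOp]
  · rw [hm.2, conjBy_mul, conjBy_shift_amp hΘ]
    -- The component changed by the coupling is moved from the place `1` to the place `0`.
    by_cases hn : n = 0
    · subst hn
      have h1 : (coordFun 0 f).comp ⟨globalMap φ, (globalMap φ).continuous⟩ =
          pairFun 1 (fun p => f (φ p).2) := by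
        ext x
        change f (Function.update x.2 1 (φ (x.1, x.2 1)).2 (0 + 1)) = f (φ (x.1, x.2 1)).2
        simp
      rw [h1, hm.map_pairFun, ← pairOp_snd, zero_add, conjBy_ampUnitary_one,
        conjBy_permUnitary_pairOp]
    · have h1 : (coordFun n f).comp ⟨globalMap φ, (globalMap φ).continuous⟩ =
          coordFun (n + 1) f := by
        ext x
        change f (Function.update x.2 1 (φ (x.1, x.2 1)).2 (n + 1)) = f (x.2 (n + 1))
        rw [Function.update_of_ne (by omega)]
      rw [h1, hm.2, conjBy_ampUnitary_of_ne _ _ (by omega)]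

end Covariance

/-! ### Injectivity -/

section Injectivity

variable {E G : Type*} [Fintype E] [DecidableEq E] [TopologicalSpace E]
  [Fintype G] [DecidableEq G] [TopologicalSpace G]
  {ψ : Metric.sphere (0 : EuclideanSpace ℂ G) 1}
  {m : C(E × (ℤ → G), ℂ) →⋆ₐ[ℂ] Op (HilbertTensor (EuclideanSpace ℂ E) (StabTensor ψ))}

/-- A product of functions of the coordinates acts on a product vector place by place. -/
lemma IsMultiplication.apply_prod (hm : IsMultiplication m) (s : Finset ℤ) (g : ℤ → C(G, ℂ))
    (h : EuclideanSpace ℂ E) (u : StabFamily fun _ : ℤ => ψ) :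
    ∃ v : StabFamily fun _ : ℤ => ψ,
      (∀ n, v.vec n = if n ∈ s then diagOp (g n : G → ℂ) (u.vec n) else u.vec n) ∧
      m (∏ n ∈ s, coordFun n (g n)) (vecTensor h (tprod _ u)) = vecTensor h (tprod _ v) := by
  induction s using Finset.induction_on with
  | empty => exact ⟨u, by simp, by simp⟩
  | insert n s hn ih =>
    obtain ⟨v, hv, hmv⟩ := ih
    refine ⟨v.update n (diagOp (g n : G → ℂ) (v.vec n)), fun k => ?_, ?_⟩
    · by_cases hk : k = n
      · subst hk; simp [hv, hn]
      · simp [StabFamily.update_vec_of_ne _ hk, hv, hk]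
    · rw [Finset.prod_insert hn, map_mul, mul_apply_eq_comp, hmv, hm.2, amp_opTensor_vecTensor]
      rfl

variable [DiscreteTopology E] [DiscreteTopology G]

/-- Near a point `x` with `F x ≠ 0`, `F` is almost constant on a cylinder, and the indicator of the
cylinder is represented by a projection with a product vector in its range. -/
lemma IsMultiplication.injective (hm : IsMultiplication m) : Function.Injective m := by
  rw [injective_iff_map_eq_zero]
  intro F hF
  by_contra hne
  obtain ⟨x, hx⟩ : ∃ x, F x ≠ 0 := by
    by_contra! h
    exact hne (ContinuousMap.ext h)
  have hε : 0 < ‖F x‖ / 2 := by positivity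
  have hopen : {y | dist (F y) (F x) < ‖F x‖ / 2} ∈ nhds x :=
    F.continuous.continuousAt (Metric.ball_mem_nhds _ hε)
  rw [nhds_prod_eq, Filter.mem_prod_iff] at hopen
  obtain ⟨t₁, ht₁, t₂, ht₂, ht⟩ := hopen
  rw [nhds_pi, Filter.mem_pi'] at ht₂
  obtain ⟨s, w, hw, hws⟩ := ht₂
  let f : C(E, ℂ) := ⟨Pi.single x.1 1, continuous_of_discreteTopology⟩
  let g : ℤ → C(G, ℂ) := fun n => ⟨Pi.single (x.2 n) 1, continuous_of_discreteTopology⟩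
  set C : C(E × (ℤ → G), ℂ) := sysFun f * ∏ n ∈ s, coordFun n (g n) with hC
  have hle : ‖F * C - F x • C‖ ≤ ‖F x‖ / 2 := by
    rw [ContinuousMap.norm_le _ hε.le]
    intro y
    have h1 : (F * C - F x • C) y = (F y - F x) * C y := by simp [sub_mul]
    rw [h1, norm_mul]
    by_cases hy : y.1 = x.1 ∧ ∀ n ∈ s, y.2 n = x.2 n
    · have h2 : C y = 1 := by
        simp only [hC, ContinuousMap.mul_apply, ContinuousMap.prod_apply, sysFun_apply,
          coordFun_apply, f, g, ContinuousMap.coe_mk, hy.1, Pi.single_eq_same, one_mul]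
        exact Finset.prod_eq_one fun n hn => by rw [hy.2 n hn, Pi.single_eq_same]
      have h3 : y ∈ t₁ ×ˢ t₂ := by
        refine ⟨hy.1 ▸ mem_of_mem_nhds ht₁, hws fun n hn => ?_⟩
        rw [hy.2 n hn]
        exact mem_of_mem_nhds (hw n)
      have h4 : dist (F y) (F x) < ‖F x‖ / 2 := ht h3
      rw [h2, norm_one, mul_one, ← dist_eq_norm]
      exact h4.le
    · have h2 : C y = 0 := by
        simp only [hC, ContinuousMap.mul_apply, ContinuousMap.prod_apply, sysFun_apply,
          coordFun_apply, f, g, ContinuousMap.coe_mk]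
        by_cases h : y.1 = x.1
        · have : ∃ n ∈ s, y.2 n ≠ x.2 n := by
            by_contra! h'
            exact hy ⟨h, h'⟩
          obtain ⟨n, hn, hne⟩ := this
          rw [Finset.prod_eq_zero hn (by simp [hne]), mul_zero]
        · simp [h]
      rw [h2, norm_zero, mul_zero]
      exact hε.le
  let u : StabFamily fun _ : ℤ => ψ :=
    ⟨fun n => if n ∈ s then EuclideanSpace.single (x.2 n) 1 else ψ,
      s.finite_toSet.subset fun n hn => by
        by_contra h
        exact hn (if_neg h)⟩
  set z := vecTensor (EuclideanSpace.single x.1 (1 : ℂ)) (tprod _ u) with hz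
  have hCz : m C z = z := by
    obtain ⟨v, hv, hmv⟩ := hm.apply_prod s g (EuclideanSpace.single x.1 (1 : ℂ)) u
    have hvu : v = u := by
      ext n : 1
      rw [hv]
      by_cases hn : n ∈ s
      · simp [u, hn, g]
      · simp [hn]
    rw [hC, map_mul, mul_apply_eq_comp, hz, hmv, hvu, hm.1, opTensor_vecTensor]
    simp [f]
  have hz1 : ‖z‖ = 1 := by
    have h1 : ⟪tprod (fun _ : ℤ => ψ) u, tprod _ u⟫_ℂ = 1 := by
      rw [inner_tprod]
      refine finprod_eq_one_of_forall_eq_one fun n => ?_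
      by_cases hn : n ∈ s
      · simp [u, hn]
      · simp [u, hn]
    rw [hz, norm_vecTensor, @norm_eq_sqrt_re_inner ℂ _ _ _ _ (tprod _ u), h1]
    simp
  have h1 : m (F * C - F x • C) z = -(F x • z) := by
    rw [map_sub, map_mul, hF, zero_mul, zero_sub, map_smul, _root_.neg_apply,
      _root_.smul_apply, hCz]
  have h2 : ‖m (F * C - F x • C) z‖ ≤ ‖F x‖ / 2 := by
    refine (ContinuousLinearMap.le_opNorm _ _).trans ?_
    rw [hz1, mul_one]
    exact (NonUnitalStarAlgHom.norm_apply_le m _).trans hle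
  rw [h1, norm_neg, norm_smul, hz1, mul_one] at h2
  linarith

end Injectivity

/-! ### Distributions of the observables -/

section Expectation

/-- The integral with respect to a probability measure as a bounded functional on `C(X)`. -/
def integralCLM {X : Type*} [TopologicalSpace X] [CompactSpace X] [MeasurableSpace X]
    [OpensMeasurableSpace X] (μ : MeasureTheory.Measure X) [MeasureTheory.IsProbabilityMeasure μ] :
    C(X, ℂ) →L[ℂ] ℂ :=
  have hi : ∀ F : C(X, ℂ), MeasureTheory.Integrable F μ := fun F =>
    F.continuous.integrable_of_hasCompactSupport (HasCompactSupport.of_compactSpace _)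
  LinearMap.mkContinuous
    { toFun := fun F => ∫ x, F x ∂μ
      map_add' := fun F F' => MeasureTheory.integral_add (hi F) (hi F')
      map_smul' := fun c F => MeasureTheory.integral_const_mul c _ } 1
    fun F => by
      have := MeasureTheory.norm_integral_le_of_norm_le_const (μ := μ) (f := F) (C := ‖F‖)
        (Filter.Eventually.of_forall fun x => F.norm_coe_le_norm x)
      simpa using this

/-- The vector functional `A ↦ ⟪z, A z⟫`. -/
def vectorFunctional {X : Type*} [NormedAddCommGroup X] [InnerProductSpace ℂ X] (z : X) :
    Op X →L[ℂ] ℂ :=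
  innerSL ℂ z ∘L ContinuousLinearMap.apply ℂ X z

variable {E G : Type*} [TopologicalSpace E] [MeasurableSpace E] [BorelSpace E] [Fintype G]
  [TopologicalSpace G] [DiscreteTopology G] [MeasurableSpace G] [BorelSpace G]

open MeasureTheory in
lemma integral_dirac_prod_infinitePi (μ : Measure G) [IsProbabilityMeasure μ] (k : E) (f : C(E, ℂ))
    (s : Finset ℤ) (g : ℤ → C(G, ℂ)) :
    ∫ x, (sysFun f * ∏ n ∈ s, coordFun n (g n) : C(E × (ℤ → G), ℂ)) x
      ∂((Measure.dirac k).prod (Measure.infinitePi fun _ : ℤ => μ)) =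
      f k * ∏ n ∈ s, ∫ y, g n y ∂μ := by
  rw [Measure.dirac_prod, integral_map (by fun_prop)
    (ContinuousMap.continuous _).aestronglyMeasurable]
  simp only [ContinuousMap.mul_apply, ContinuousMap.prod_apply, sysFun_apply, coordFun_apply]
  rw [integral_const_mul]
  congr 1
  have h := integral_restrict_infinitePi (μ := fun _ : ℤ => μ) (s := s)
    (f := fun y => ∏ n, g n.1 (y n)) (by
      refine Continuous.aestronglyMeasurable ?_
      fun_prop)
  rw [integral_fintype_prod_eq_prod (fun n : s => (g n.1 : G → ℂ))] at h
  rw [← Finset.prod_coe_sort s (fun n => ∫ y, g n y ∂μ), ← h]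
  refine integral_congr_ae (Filter.Eventually.of_forall fun y => ?_)
  exact (Finset.prod_coe_sort s (fun n => g n (y n))).symm

variable [Fintype E] [DecidableEq E] [DiscreteTopology E] [DecidableEq G]
  {ψ : Metric.sphere (0 : EuclideanSpace ℂ G) 1}
  {m : C(E × (ℤ → G), ℂ) →⋆ₐ[ℂ] Op (HilbertTensor (EuclideanSpace ℂ E) (StabTensor ψ))}

open MeasureTheory in
/-- If `μ` is the distribution of the one-site observables in the state `ψ`, then the distribution
of the global observables in the state `k ⊗ ⨂ ψ` is `δ_k ⊗ ⨂ μ`. -/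
lemma IsMultiplication.inner_constVec (hm : IsMultiplication m) (μ : Measure G)
    [IsProbabilityMeasure μ]
    (hμ : ∀ g : C(G, ℂ), ⟪(ψ : EuclideanSpace ℂ G), diagOp (g : G → ℂ) ψ⟫_ℂ = ∫ y, g y ∂μ)
    (k : E) (F : C(E × (ℤ → G), ℂ)) :
    ⟪vecTensor (EuclideanSpace.single k (1 : ℂ)) (constVec ψ),
      m F (vecTensor (EuclideanSpace.single k (1 : ℂ)) (constVec ψ))⟫_ℂ =
      ∫ x, F x ∂((Measure.dirac k).prod (Measure.infinitePi fun _ : ℤ => μ)) := by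
  set z := vecTensor (EuclideanSpace.single k (1 : ℂ)) (constVec ψ) with hz
  have h : (vectorFunctional z) ∘L (⟨m.toAlgHom.toLinearMap, map_continuous m⟩ :
      C(E × (ℤ → G), ℂ) →L[ℂ] Op (HilbertTensor (EuclideanSpace ℂ E) (StabTensor ψ))) =
      integralCLM ((Measure.dirac k).prod (Measure.infinitePi fun _ : ℤ => μ)) := by
    refine eq_of_eq_on_products fun f s g => ?_
    refine Eq.trans ?_ (integral_dirac_prod_infinitePi μ k f s g).symm
    change ⟪z, m (sysFun f * ∏ n ∈ s, coordFun n (g n)) z⟫_ℂ = _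
    obtain ⟨v, hv, hmv⟩ := hm.apply_prod s g (EuclideanSpace.single k (1 : ℂ))
      ⟨fun _ => ψ, by simp⟩
    have hmz : m (∏ n ∈ s, coordFun n (g n)) z =
      vecTensor (EuclideanSpace.single k (1 : ℂ)) (tprod _ v) := hmv
    rw [map_mul, mul_apply_eq_comp, hmz, hm.1, opTensor_vecTensor, one_apply_eq_self, hz,
      inner_vecTensor, diagOp_single, inner_smul_right, inner_single_self, mul_one]
    congr 1
    rw [constVec, inner_tprod]
    have hv' : ∀ n, ⟪(ψ : EuclideanSpace ℂ G), v.vec n⟫_ℂ =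
        if n ∈ s then ∫ y, g n y ∂μ else 1 := by
      intro n
      rw [hv]
      by_cases hn : n ∈ s
      · rw [if_pos hn, if_pos hn, hμ]
      · rw [if_neg hn, if_neg hn, inner_sphere_self]
    rw [finprod_congr hv', finprod_eq_prod_of_mulSupport_subset (s := s)]
    · exact Finset.prod_congr rfl fun n hn => if_pos hn
    · intro n hn
      by_contra h
      exact hn (if_neg h)
  exact DFunLike.congr_fun h F

/-- A function of commuting observables `m F₁, …, m Fₙ` is represented by the function of the
`Fᵢ`. -/
lemma isJointCFC_map {X A : Type*} [TopologicalSpace X] [CompactSpace X] [CStarAlgebra A]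
    (m : C(X, ℂ) →⋆ₐ[ℂ] A) {n : ℕ} (F : Fin n → C(X, ℂ)) (η : C(Fin n → ℂ, ℂ)) :
    IsJointCFC (fun i => m (F i)) η (m (η.comp ⟨fun x i => F i x, by fun_prop⟩)) := by
  let r : C(X, Set.range fun x i => F i x) := ⟨fun x => ⟨fun i => F i x, x, rfl⟩, by fun_prop⟩
  exact ⟨Set.range fun x i => F i x, isCompact_range (by fun_prop),
    m.comp (r.compStarAlgHom' ℂ ℂ), fun i => rfl, rfl⟩

end Expectation

/-! ### The stochastic map of the automaton -/

section Automaton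

lemma sqrt_mul_sqrt_toReal {L : Type*} (q : PMF L) (β : L) :
    ((Real.sqrt (q β).toReal : ℂ)) * (Real.sqrt (q β).toReal : ℂ) = ((q β).toReal : ℂ) := by
  rw [← Complex.ofReal_mul, Real.mul_self_sqrt ENNReal.toReal_nonneg]

variable {E : Type*} [Fintype E] [DecidableEq E]

lemma integral_siteLaw [TopologicalSpace E] [DiscreteTopology E]
    [MeasurableSpace E] [MeasurableSingletonClass E] (e₀ : E) (q : PMF (E → E))
    (g : Site E → ℂ) :
    ∫ y, g y ∂(siteLaw e₀ q).toMeasure = ∑ β, ((q β).toReal : ℂ) * g (e₀, β) := by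
  have hmeas : Measurable fun β : E → E => ((e₀, β) : Site E) := by fun_prop
  rw [siteLaw, ← PMF.toMeasure_map _ q hmeas, MeasureTheory.integral_map hmeas.aemeasurable
    (Measurable.of_discrete (f := g)).aestronglyMeasurable, PMF.integral_eq_sum]
  simp

lemma inputVec_apply (e₀ : E) (q : PMF (E → E)) (f : Site E → ℂ) :
    diagOp f (inputVec e₀ q) = ∑ β : E → E,
      (Real.sqrt (q β).toReal : ℂ) • f (e₀, β) •
        EuclideanSpace.single ((e₀, β) : Site E) (1 : ℂ) := by
  rw [inputVec, map_sum]
  exact Finset.sum_congr rfl fun β _ => by rw [map_smul, diagOp_single]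

lemma inner_diagOp_inputVec (e₀ : E) (q : PMF (E → E)) (g : Site E → ℂ) :
    ⟪inputVec e₀ q, diagOp g (inputVec e₀ q)⟫_ℂ = ∑ β, ((q β).toReal : ℂ) * g (e₀, β) := by
  rw [inputVec_apply, inputVec, sum_inner]
  refine Finset.sum_congr rfl fun β _ => ?_
  rw [inner_sum, Finset.sum_eq_single β]
  · rw [inner_smul_left, inner_smul_right, inner_smul_right, inner_single_self, Complex.conj_ofReal,
      mul_one, ← mul_assoc, sqrt_mul_sqrt_toReal]
  · intro β' _ h
    have h' : ((e₀, β) : Site E) ≠ (e₀, β') := fun h' => h (Prod.ext_iff.mp h').2.symm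
    rw [inner_smul_left, inner_smul_right, inner_smul_right, inner_single_of_ne h']
    simp
  · simp

variable {e₀ : E} {φ : Equiv.Perm (E × Site E)}

lemma inputIsometry_single (hφ : IsCoupling e₀ φ) (q : PMF (E → E)) (j : E) :
    inputIsometry (permUnitary φ : Op (HilbertTensor (EuclideanSpace ℂ E)
        (EuclideanSpace ℂ (Site E)))) (inputUnit e₀ q) (EuclideanSpace.single j 1) =
      ∑ β : E → E, (Real.sqrt (q β).toReal : ℂ) • vecTensor (EuclideanSpace.single (β j) (1 : ℂ))
        (EuclideanSpace.single ((j, β) : Site E) (1 : ℂ)) := by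
  change (permUnitary φ : Op (HilbertTensor (EuclideanSpace ℂ E)
        (EuclideanSpace ℂ (Site E)))) (tensorLeft (EuclideanSpace.single j 1) (inputVec e₀ q)) = _
  rw [inputVec, map_sum, map_sum]
  refine Finset.sum_congr rfl fun β _ => ?_
  rw [map_smul, map_smul, tensorLeft_apply, permUnitary_single, hφ]

/-- Distinct pairs `(j, β)` label orthogonal outputs, so diagonal operators stay diagonal. -/
lemma stinespringMap_diagOp (hφ : IsCoupling e₀ φ) (q : PMF (E → E)) (f : E → ℂ) :
    stinespringMap (inputIsometry (permUnitary φ : Op (HilbertTensor (EuclideanSpace ℂ E)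
        (EuclideanSpace ℂ (Site E)))) (inputUnit e₀ q)) (diagOp f) =
      diagOp fun j => ∑ β : E → E, ((q β).toReal : ℂ) * f (β j) := by
  refine inner_map_eq_of_total _ (dense_span_single E) _ _ fun i j => ?_
  rw [inner_stinespringMap, inputIsometry_single hφ, inputIsometry_single hφ, map_sum,
    diagOp_single, inner_smul_right]
  simp only [map_smul, opTensor_vecTensor, one_apply_eq_self, diagOp_single, sum_inner, inner_sum,
    inner_smul_left, inner_smul_right, vecTensor_smul_left, inner_vecTensor, Complex.conj_ofReal]
  by_cases hij : i = j
  · subst hij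
    rw [inner_single_self, mul_one]
    refine Finset.sum_congr rfl fun β _ => ?_
    rw [Finset.sum_eq_single β]
    · rw [inner_single_self, inner_single_self, ← sqrt_mul_sqrt_toReal]
      ring
    · intro β' _ h
      have h' : ((i, β') : Site E) ≠ (i, β) := fun h' => h (Prod.ext_iff.mp h').2
      simp only [inner_single_of_ne h', mul_zero]
    · simp
  · have h0 : ∀ β β' : E → E, ((i, β) : Site E) ≠ (j, β') :=
      fun β β' h => hij (Prod.ext_iff.mp h).1
    simp only [inner_single_of_ne hij, inner_single_of_ne (h0 _ _), mul_zero, Finset.sum_const_zero]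

lemma IsDeterministicMixture.mulVec {P : Matrix E E ℝ} {q : PMF (E → E)}
    (hq : IsDeterministicMixture P q) (f : E → ℂ) (j : E) :
    (P.map Complex.ofReal).mulVec f j = ∑ β : E → E, ((q β).toReal : ℂ) * f (β j) := by
  have hP : ∀ k, P j k = ∑ β : E → E, (q β).toReal * if β j = k then 1 else 0 := by
    intro k
    rw [hq, Matrix.sum_apply]
    rfl
  simp only [Matrix.mulVec, dotProduct, Matrix.map_apply, hP, Complex.ofReal_sum,
    Complex.ofReal_mul, Finset.sum_mul]
  rw [Finset.sum_comm]
  refine Finset.sum_congr rfl fun β _ => ?_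
  rw [Finset.sum_eq_single (β j)]
  · simp
  · intro k _ h
    simp [Ne.symm h]
  · simp

lemma extendsSemigroup_diagOp {P : Matrix E E ℝ} {T : Op (EuclideanSpace ℂ E) →ₗ[ℂ]
    Op (EuclideanSpace ℂ E)}
    (hT : ∀ f, T (diagOp f) = diagOp ((P.map Complex.ofReal).mulVec f)) :
    ExtendsSemigroup P T diagOp fun k => pureState (EuclideanSpace.single k 1) := by
  refine ⟨diagOp_injective, hT, fun k => isState_pureState (by simp), fun k f t => ?_⟩
  have h : ∀ t : ℕ, ∀ f, (T ^ t) (diagOp f) = diagOp (((P ^ t).map Complex.ofReal).mulVec f) := by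
    intro t
    induction t with
    | zero =>
      intro f
      simp
    | succ t ih =>
      intro f
      rw [pow_succ, Module.End.mul_apply, hT, ih, Matrix.mulVec_mulVec, pow_succ]
      congr 2
      exact (Matrix.map_mul (f := Complex.ofRealHom)).symm
  have h1 := hasTrace_mul_pureState ((T ^ t) (diagOp f)) (EuclideanSpace.single k (1 : ℂ))
  rwa [h, diagOp_single, inner_smul_right, inner_single_self, mul_one, ← h] at h1

end Automaton

end MarkovDilation

end

set_option maxHeartbeats 1000000 in
theorem theorem2 {E : Type*} [Fintype E] [DecidableEq E] [TopologicalSpace E] [DiscreteTopology E]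
    [MeasurableSpace E] [MeasurableSingletonClass E]
    (P : Matrix E E ℝ) (hP : P ∈ Matrix.rowStochastic ℝ E)
    (e₀ : E) (φ : Equiv.Perm (E × Site E)) (hφ : IsCoupling e₀ φ)
    (q : PMF (E → E)) (hq : IsDeterministicMixture P q) :
    ∃ T : Op (EuclideanSpace ℂ E) →ₗ[ℂ] Op (EuclideanSpace ℂ E),
      IsStochasticMap T ∧
      IsDilation T (permUnitary φ) (pureState (inputVec e₀ q)) ∧
      ∃ (m₀ : (E → ℂ) →⋆ₐ[ℂ] Op (EuclideanSpace ℂ E))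
        (ρ : E → Op (EuclideanSpace ℂ E)),
        ExtendsSemigroup P T m₀ ρ ∧
        ∃ U, IsAssociatedEvolution (permUnitary φ) (inputUnit e₀ q) U ∧
          IsSemigroupDilation T U (pureState (constVec (inputUnit e₀ q))) ∧
          ∃ m, ExtendsDilation (globalMap φ)
              (MeasureTheory.Measure.infinitePi fun _ : ℤ => (siteLaw e₀ q).toMeasure)
              U (pureState (constVec (inputUnit e₀ q))) m ρ ∧
            ∀ f : E → ℂ, m ⟨fun x => f x.1, continuous_of_discreteTopology.comp continuous_fst⟩ =
              opTensor (m₀ f) 1 := by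
  obtain ⟨Θ, hΘ⟩ := exists_isShift (H := EuclideanSpace ℂ E) (inputUnit e₀ q)
  obtain ⟨m, hm⟩ := exists_isMultiplication E (inputUnit e₀ q)
  have hV := isAmpliation_amp (fun _ : ℤ => inputUnit e₀ q) 1 (permUnitary φ).1
  have hT : ∀ f, stinespringMap (inputIsometry (permUnitary φ).1 (inputUnit e₀ q)) (diagOp f) =
      diagOp ((P.map Complex.ofReal).mulVec f) := fun f => by
    rw [stinespringMap_diagOp hφ]
    congr 1
    funext j
    rw [hq.mulVec]
  refine ⟨stinespringMap (inputIsometry (permUnitary φ).1 (inputUnit e₀ q)),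
    isStochasticMap_stinespringMap (EuclideanSpace.basisFun (Site E) ℂ) _
      (adjoint_comp_inputIsometry _ _),
    ⟨isState_pureState (norm_inputVec e₀ q), fun a =>
      isCondExp_pureState (EuclideanSpace.basisFun E ℂ) fun h h' => ?_⟩,
    diagOp, fun k => pureState (EuclideanSpace.single k 1), extendsSemigroup_diagOp hT,
    Θ * ampUnitary _ (permUnitary φ), ⟨Θ, _, hΘ, hV, rfl⟩,
    isSemigroupDilation_evolution (EuclideanSpace.basisFun E ℂ) hΘ hV, m,
    ⟨hm.injective, fun F t => ?_, fun k => isState_pureState (by simp), fun k n F η => ?_⟩,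
    fun f => hm.1 ⟨f, continuous_of_discreteTopology⟩⟩
  · rw [inner_stinespringMap, inner_conjBy]
    rfl
  · exact conjBy_zpow_map m _ _ (hm.conjBy_evolution hΘ φ) t F
  · refine ⟨_, isJointCFC_map m F _, ?_⟩
    rw [opTensor_pureState]
    have h := hasTrace_mul_pureState (m (ContinuousMap.comp ⟨fun z => (η z : ℂ), by fun_prop⟩
      ⟨fun x i => F i x, by fun_prop⟩)) (vecTensor (EuclideanSpace.single k (1 : ℂ))
        (constVec (inputUnit e₀ q)))
    rw [hm.inner_constVec (siteLaw e₀ q).toMeasure (fun g =>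
      (inner_diagOp_inputVec e₀ q g).trans (integral_siteLaw e₀ q g).symm)] at h
    convert h using 1
    exact integral_ofReal.symm
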